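/- Let $G$ be a discrete group. All compact $G$-spaces are compact Hausdorff spaces on which $G$ acts by homeomorphisms; for such $X$, $G$ acts on $C(X)$ by $(sf)(x)=f(s^{-1}x)$, and $G$ acts on $\ell^\infty(G)$ by $(sf)(t)=f(s^{-1}t)$. A $G$-operator system is a unital self-adjoint subspace of a unital C*-algebra with an action of $G$ by unital complete order automorphisms. A $G$-operator system $\mathcal U$ is $G$-injective if unital completely positive $G$-equivariant maps $\mathcal S\to\mathcal U$ extend along unital completely isometric $G$-equivariant maps $\mathcal S\to\mathcal T$. A $G$-injective envelope of $\mathbb C$ (with trivial action) is a $G$-injective $\mathcal U$ with a unital completely isometric $G$-equivariant map $\iota:\mathbb C\to\mathcal U$ that is $G$-essential: every unital completely positive $G$-equivariant map $\phi:\mathcal U\to\mathcal T$ with $\phi\iota$ completely isometric is itself completely isometric. A Hamana boundary of $G$ is a compact $G$-space $X$ such that $C(X)$ is a $G$-injective envelope of $\mathbb C$. A $G$-boundary is a nonempty compact $G$-space that is minimal (every orbit is dense) and strongly proximal (the weak* closure of the $G$-orbit of every regular Borel probability measure contains a point mass). A Furstenberg boundary is a $G$-boundary of which every $G$-boundary is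 a continuous $G$-equivariant image. The group $G$ is amenable if $\ell^\infty(G)$ has a unital positive linear functional invariant under left translation. A unital positive $G$-equivariant projection $\psi$ on $\ell^\infty(G)$ is called minimal if its image is minimal under inclusion among the images of such projections; its image is given the Choi–Effros product $a\cdot b=\psi(ab)$. Then the following hold. 1. A Hamana boundary $\partial_H G$ of $G$ exists and is unique up to $G$-equivariant homeomorphism, and every $G$-injective envelope of $\mathbb C$ is isomorphic to $C(\partial_H G)$ by a unital completely isometric $G$-equivariant linear bijection. 2. Minimal unital positive $G$-equivariant projections on $\ell^\infty(G)$ exist. For each of them the image, with the Choi–Effros product, is $G$-equivariantly and isometrically *-isomorphic to $C(\partial_H G)$; for at least one of them the image is a C*-subalgebra of $\ell^\infty(G)$, that is, the isomorphism is a *-homomorphism from $C(\partial_H G)$ into $\ell^\infty(G)$. Conversely, if $X$ is a compact $G$-space and $C(X)$ is $G$-equivariantly and isometrically *-isomorphic to the image of a minimal projection with the Choi–Effros product, then $X$ is a Hamana boundary. 3. $\partial_H G$ is nonempty, minimal and strongly proximal, so it is a $G$-boundary. 4. For every $G$-boundary $B$ there is a continuous $G$-equivariant map from $\partial_H G$ onto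 $B$. Hence $\partial_H G$ is the Furstenberg boundary $\partial_F G$: a compact $G$-space is a Hamana boundary if and only if it is a Furstenberg boundary. 5. $\partial_H G$ is a single point if and only if $G$ is amenable. -/

import Mathlib

open scoped ComplexOrder ENNReal

universe u v w

noncomputable section

/-! ### Operator systems with a group action -/

/-- A `G`-operator system: a unital self-adjoint subspace `carrier` of a unital C*-algebra
`Ambient`, with an action of `G` by unital complete order automorphisms (each `act s` is unital and
completely positive, and so is its inverse `act s⁻¹`). The order on `Ambient` is determined by
`StarOrderedRing`: it is the usual order of the C*-algebra. -/
structure GOperatorSystem (G : Type u) [Group G] where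
  Ambient : Type v
  [cstar : CStarAlgebra Ambient]
  [order : PartialOrder Ambient]
  [starOrdered : StarOrderedRing Ambient]
  carrier : Submodule ℂ Ambient
  one_mem : (1 : Ambient) ∈ carrier
  star_mem : ∀ a ∈ carrier, star a ∈ carrier
  act : G →* Module.End ℂ carrier
  act_one : ∀ s, act s ⟨1, one_mem⟩ = ⟨1, one_mem⟩
  act_completelyPositive : ∀ (s : G) (n : ℕ) (M : CStarMatrix (Fin n) (Fin n) carrier),
    0 ≤ M.map (fun x => (x : Ambient)) → 0 ≤ M.map (fun x => (act s x : Ambient))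

attribute [instance] GOperatorSystem.cstar GOperatorSystem.order GOperatorSystem.starOrdered

namespace GOperatorSystem

variable {G : Type u} [Group G]

/-- The unit of an operator system. -/
def unit (S : GOperatorSystem.{u, v} G) : S.carrier := ⟨1, S.one_mem⟩

/-- `φ` is a unital map of operator systems. -/
def IsUnital {S : GOperatorSystem.{u, v} G} {T : GOperatorSystem.{u, w} G}
    (φ : S.carrier →ₗ[ℂ] T.carrier) : Prop :=
  φ S.unit = T.unit

/-- `φ` commutes with the `G`-actions. -/
def IsEquivariant {S : GOperatorSystem.{u, v} G} {T : GOperatorSystem.{u, w} G}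
    (φ : S.carrier →ₗ[ℂ] T.carrier) : Prop :=
  ∀ (s : G) (x : S.carrier), φ (S.act s x) = T.act s (φ x)

/-- All matrix amplifications of `φ` are positive. -/
def IsCompletelyPositive {S : GOperatorSystem.{u, v} G} {T : GOperatorSystem.{u, w} G}
    (φ : S.carrier →ₗ[ℂ] T.carrier) : Prop :=
  ∀ (n : ℕ) (M : CStarMatrix (Fin n) (Fin n) S.carrier),
    0 ≤ M.map (fun x => (x : S.Ambient)) → 0 ≤ M.map (fun x => (φ x : T.Ambient))

/-- All matrix amplifications of `φ` are isometric. -/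
def IsCompletelyIsometric {S : GOperatorSystem.{u, v} G} {T : GOperatorSystem.{u, w} G}
    (φ : S.carrier →ₗ[ℂ] T.carrier) : Prop :=
  ∀ (n : ℕ) (M : CStarMatrix (Fin n) (Fin n) S.carrier),
    ‖M.map (fun x => (φ x : T.Ambient))‖ = ‖M.map (fun x => (x : S.Ambient))‖

/-- Unital completely positive `G`-equivariant maps. -/
structure IsGUCP {S : GOperatorSystem.{u, v} G} {T : GOperatorSystem.{u, w} G}
    (φ : S.carrier →ₗ[ℂ] T.carrier) : Prop where
  unital : IsUnital φ
  completelyPositive : IsCompletelyPositive φ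
  equivariant : IsEquivariant φ

/-- Unital completely isometric `G`-equivariant maps; `(T, φ)` is then a `G`-extension of `S`. -/
structure IsGExtension {S : GOperatorSystem.{u, v} G} {T : GOperatorSystem.{u, w} G}
    (φ : S.carrier →ₗ[ℂ] T.carrier) : Prop where
  unital : IsUnital φ
  completelyIsometric : IsCompletelyIsometric φ
  equivariant : IsEquivariant φ

/-- `G`-injectivity: unital completely positive `G`-equivariant maps into `U` extend along
unital completely isometric `G`-equivariant maps. -/
def IsGInjective (U : GOperatorSystem.{u, v} G) : Prop :=
  ∀ (S T : GOperatorSystem.{u, v} G) (ι : S.carrier →ₗ[ℂ] T.carrier)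
    (φ : S.carrier →ₗ[ℂ] U.carrier), IsGExtension ι → IsGUCP φ →
    ∃ φ' : T.carrier →ₗ[ℂ] U.carrier, IsGUCP φ' ∧ φ' ∘ₗ ι = φ

/-- `G`-essentiality of an extension `ι : S → U`. -/
def IsGEssential {S : GOperatorSystem.{u, v} G} {U : GOperatorSystem.{u, w} G}
    (ι : S.carrier →ₗ[ℂ] U.carrier) : Prop :=
  ∀ (T : GOperatorSystem.{u, w} G) (φ : U.carrier →ₗ[ℂ] T.carrier), IsGUCP φ →
    IsCompletelyIsometric (φ ∘ₗ ι) → IsCompletelyIsometric φ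

/-- `(U, ι)` is a `G`-injective envelope of `S`. -/
structure IsGInjectiveEnvelope {S : GOperatorSystem.{u, v} G} {U : GOperatorSystem.{u, w} G}
    (ι : S.carrier →ₗ[ℂ] U.carrier) : Prop where
  extension : IsGExtension ι
  injective : IsGInjective U
  essential : IsGEssential ι

variable (G)

/-- `ℂ` with the trivial `G`-action. -/
def complex : GOperatorSystem.{u, 0} G where
  Ambient := ℂ
  carrier := ⊤
  one_mem := trivial
  star_mem _ _ := trivial
  act := 1
  act_one _ := rfl
  act_completelyPositive _ _ _ h := h

variable (X : Type v) [TopologicalSpace X] [CompactSpace X] [MulAction G X]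
  [ContinuousConstSMul G X]

/-- The translation `(s f)(x) = f (s⁻¹ x)` on `C(X)`. -/
def translate {G : Type u} [Group G] (X : Type v) [TopologicalSpace X] [CompactSpace X]
    [MulAction G X] [ContinuousConstSMul G X] (s : G) : C(X, ℂ) →⋆ₐ[ℂ] C(X, ℂ) :=
  ContinuousMap.compStarAlgHom' ℂ ℂ ⟨fun x => s⁻¹ • x, continuous_const_smul s⁻¹⟩

/-- `C(X)` with the `G`-action induced by the `G`-action on the compact space `X`. -/
def continuousFunctions : GOperatorSystem.{u, v} G where
  Ambient := C(X, ℂ)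
  carrier := ⊤
  one_mem := trivial
  star_mem _ _ := trivial
  act :=
    { toFun := fun s =>
        { toFun := fun f => ⟨translate X s f.1, trivial⟩
          map_add' := fun f g => by ext x; rfl
          map_smul' := fun c f => by ext x; rfl }
      map_one' := by
        ext f x
        change f.1 ((1 : G)⁻¹ • x) = f.1 x
        rw [inv_one, one_smul]
      map_mul' := fun s t => by
        ext f x
        change f.1 ((s * t)⁻¹ • x) = f.1 (t⁻¹ • s⁻¹ • x)
        rw [mul_inv_rev, mul_smul] }
  act_one _ := rfl
  act_completelyPositive s n M h :=
    CompletelyPositiveMapClass.map_cstarMatrix_nonneg' (translate X s) n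
      (M.map (fun x => (x : C(X, ℂ)))) h

end GOperatorSystem

/-! ### Compact `G`-spaces

For a discrete group `G`, a compact `G`-space is a compact Hausdorff space with an action of `G` by
homeomorphisms, i.e. with instances `MulAction G X` and `ContinuousConstSMul G X`. -/

section Spaces

variable (G : Type u) [Group G]

/-- `X` is a Hamana boundary of `G`: `C(X)` with the induced action is a `G`-injective envelope of
`ℂ`. -/
def IsHamanaBoundary (X : Type v) [TopologicalSpace X] [CompactSpace X] [MulAction G X]
    [ContinuousConstSMul G X] : Prop :=
  ∃ ι : (GOperatorSystem.complex G).carrier →ₗ[ℂ]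
      (GOperatorSystem.continuousFunctions G X).carrier,
    GOperatorSystem.IsGInjectiveEnvelope ι

/-- Strong proximality: the weak* closure of the orbit of every (regular Borel) probability measure
contains a point mass. The topology on `ProbabilityMeasure X` is that of convergence of the
integrals of continuous functions. -/
def IsStronglyProximal (X : Type v) [TopologicalSpace X] [MulAction G X]
    [ContinuousConstSMul G X] : Prop :=
  letI : MeasurableSpace X := borel X
  haveI : BorelSpace X := ⟨rfl⟩
  ∀ ν : MeasureTheory.ProbabilityMeasure X, (ν : MeasureTheory.Measure X).Regular →
    ∃ x : X, MeasureTheory.diracProba x ∈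
      closure (Set.range fun s : G =>
        ν.map (f := fun y => s • y) (continuous_const_smul s).measurable.aemeasurable)

/-- A `G`-boundary: a nonempty compact Hausdorff `G`-space that is minimal and strongly proximal. -/
structure IsGBoundary (X : Type v) [TopologicalSpace X] [MulAction G X]
    [ContinuousConstSMul G X] : Prop where
  nonempty : Nonempty X
  compact : CompactSpace X
  hausdorff : T2Space X
  minimal : MulAction.IsMinimal G X
  stronglyProximal : IsStronglyProximal G X

/-- `Y` is a continuous `G`-equivariant image of `X`. -/
def IsGImage (X : Type v) [TopologicalSpace X] [MulAction G X]
    (Y : Type w) [TopologicalSpace Y] [MulAction G Y] : Prop :=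
  ∃ f : X → Y, Continuous f ∧ Function.Surjective f ∧ ∀ (s : G) (x : X), f (s • x) = s • f x

/-- `X` is a Furstenberg boundary of `G`: a `G`-boundary of which every `G`-boundary is a continuous
`G`-equivariant image. -/
def IsFurstenbergBoundary (X : Type v) [TopologicalSpace X] [MulAction G X]
    [ContinuousConstSMul G X] : Prop :=
  IsGBoundary G X ∧
    ∀ (B : Type v) [TopologicalSpace B] [MulAction G B] [ContinuousConstSMul G B],
      IsGBoundary G B → IsGImage G X B

end Spaces

/-! ### The algebra `ℓ^∞(G)` -/

/-- `ℓ^∞(G)`. -/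
abbrev EllInfty (G : Type u) : Type u := lp (fun _ : G => ℂ) ∞

namespace EllInfty

variable {G : Type u} [Group G]

/-- Left translation `(s f)(t) = f (s⁻¹ t)` on `ℓ^∞(G)`. -/
def translate (s : G) (f : EllInfty G) : EllInfty G :=
  ⟨fun t => f (s⁻¹ * t), by
    obtain ⟨C, hC⟩ := memℓp_infty_iff.1 (lp.memℓp f)
    refine memℓp_infty ⟨C, ?_⟩
    rintro _ ⟨t, rfl⟩
    exact hC ⟨s⁻¹ * t, rfl⟩⟩

/-- A unital positive `G`-equivariant projection on `ℓ^∞(G)`. -/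
structure IsGProjection (ψ : EllInfty G →ₗ[ℂ] EllInfty G) : Prop where
  unital : ψ 1 = 1
  positive : ∀ f : EllInfty G, (∀ t, 0 ≤ f t) → ∀ t, 0 ≤ ψ f t
  equivariant : ∀ (s : G) (f : EllInfty G), ψ (translate s f) = translate s (ψ f)
  idempotent : ∀ f : EllInfty G, ψ (ψ f) = ψ f

/-- A unital positive `G`-equivariant projection whose image is minimal under inclusion among the
images of all such projections. -/
structure IsMinimalGProjection (ψ : EllInfty G →ₗ[ℂ] EllInfty G) : Prop where
  projection : IsGProjection ψ
  minimal : ∀ ψ' : EllInfty G →ₗ[ℂ] EllInfty G, IsGProjection ψ' →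
    LinearMap.range ψ' ≤ LinearMap.range ψ → LinearMap.range ψ' = LinearMap.range ψ

/-- `j` identifies the C*-algebra `C(X)`, `G`-equivariantly and isometrically, with the image of
the projection `ψ` on `ℓ^∞(G)`, where the image carries the Choi-Effros product
`a · b = ψ (a b)`. -/
structure IsImageIso {X : Type v} [TopologicalSpace X] [CompactSpace X] [MulAction G X]
    [ContinuousConstSMul G X] (ψ : EllInfty G →ₗ[ℂ] EllInfty G)
    (j : C(X, ℂ) →ₗ[ℂ] EllInfty G) : Prop where
  range_eq : LinearMap.range j = LinearMap.range ψ
  norm_map : ∀ f, ‖j f‖ = ‖f‖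
  map_one : j 1 = 1
  map_star : ∀ f, j (star f) = star (j f)
  map_mul : ∀ f g, j (f * g) = ψ (j f * j g)
  equivariant : ∀ (s : G) (f : C(X, ℂ)),
    j (GOperatorSystem.translate X s f) = translate s (j f)

end EllInfty

/-- `G` is amenable: there is a left-invariant mean, i.e. a unital positive linear functional on
`ℓ^∞(G)` that is invariant under left translation. -/
def IsAmenable (G : Type u) [Group G] : Prop :=
  ∃ m : EllInfty G →ₗ[ℂ] ℂ, m 1 = 1 ∧ (∀ f : EllInfty G, (∀ t, 0 ≤ f t) → 0 ≤ m f) ∧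
    ∀ (s : G) (f : EllInfty G), m (EllInfty.translate s f) = m f

end

/-! Everything passes through one property of a compact `G`-space `X`, `IsRigidRetract`: unital
positive equivariant maps `C(X) → ℓ^∞(G)` and `ℓ^∞(G) → C(X)` exist, and the identity is the only
such map `C(X) → C(X)`. Any round trip from `C(X)` through `ℓ^∞(G)` is then the identity.

Existence (`exists_universal_boundary`). Take a minimal closed convex invariant set `K` of means on
`ℓ^∞(G)`, an extreme point `x` of `K`, and let `X` be the orbit closure of `x`. For `y` in `K` the
orbit of `y` has closed convex hull `K`, so `x` is the barycenter of a state on the functions on its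
closure. By extremality that state is the evaluation at `x`, so `x` lies in the orbit closure of
`y`. With `y` in `X` this gives minimality; with `y` the barycenter of a state on `C(X)` it gives
strong proximality. Evaluating bounded functions at the means in `X` maps `ℓ^∞(G)` to `C(X)`;
restricting to an orbit goes back.

Rigidity (`IsStateProximal.map_mul`, `IsStateProximal.isGRigid`). Proximality of `B` and minimality
of `X` make every unital positive equivariant map `C(B) → C(X)` multiplicative. For `X = B` this
also applies to the average of such a map with the identity, which forces the two to coincide.

Consequences. A state on a `G`-operator system yields, by evaluation along its orbit, an equivariant
map to `ℓ^∞(G)`, hence to `C(X)`. With Hahn-Banach this makes `C(X)` `G`-injective, and rigidity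
makes it `G`-essential over `ℂ`. Rigidity also identifies `C(X)` with every envelope of `ℂ` and with
every minimal image in `ℓ^∞(G)`, and an invariant mean collapses `X` to a point. Conversely, Hamana
boundaries, Furstenberg boundaries and spectra of minimal images are all rigid retracts, by
comparison with the space constructed above. -/

noncomputable section

/-! ### States on C*-algebras and on operator systems -/

section States

open Filter Topology Complex

/-- A unital positive linear map of ordered algebras. -/
structure IsUnitalPositive {A B : Type*} [Semiring A] [PartialOrder A] [Module ℂ A]
    [Semiring B] [PartialOrder B] [Module ℂ B] (φ : A →ₗ[ℂ] B) : Prop where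
  map_one : φ 1 = 1
  map_nonneg : ∀ a, 0 ≤ a → 0 ≤ φ a

variable {A : Type*} [CStarAlgebra A] [PartialOrder A] [StarOrderedRing A]

/-- A unital functional on an operator system that is positive takes real values on self-adjoint
elements, and these are bounded by the norm. -/
theorem OperatorSystem.apply_of_isSelfAdjoint {W : Submodule ℂ A} (h1 : (1 : A) ∈ W)
    (σ : W →ₗ[ℂ] ℂ) (hσ1 : σ ⟨1, h1⟩ = 1) (hσ : ∀ w : W, 0 ≤ (w : A) → 0 ≤ σ w) (w : W)
    (hw : IsSelfAdjoint (w : A)) : (σ w).im = 0 ∧ (σ w).re ≤ ‖(w : A)‖ := by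
  -- `‖w‖ · 1 - w` is positive.
  have h : 0 ≤ σ (((‖(w : A)‖ : ℝ) : ℂ) • ⟨1, h1⟩ - w) := by
    apply hσ
    have := hw.le_algebraMap_norm_self
    rw [Algebra.algebraMap_eq_smul_one] at this
    simpa using this
  rw [map_sub, map_smul, hσ1] at h
  have h' := Complex.nonneg_iff.1 h
  simp at h'
  exact ⟨h'.2, h'.1⟩

/-- Both `w + w*` and `i(w - w*)` are self-adjoint, so `σ` is real on them; this determines the real
and imaginary parts of `σ(w*)`. -/
theorem OperatorSystem.apply_star {W : Submodule ℂ A} (h1 : (1 : A) ∈ W)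
    (hstar : ∀ a ∈ W, star a ∈ W)
    (σ : W →ₗ[ℂ] ℂ) (hσ1 : σ ⟨1, h1⟩ = 1) (hσ : ∀ w : W, 0 ≤ (w : A) → 0 ≤ σ w) (w : W) :
    σ ⟨star (w : A), hstar _ w.2⟩ = star (σ w) := by
  have e1 := (OperatorSystem.apply_of_isSelfAdjoint h1 σ hσ1 hσ (w + ⟨star (w : A), hstar _ w.2⟩)
    (by simp)).1
  have e2 := (OperatorSystem.apply_of_isSelfAdjoint h1 σ hσ1 hσ
    (I • (w - ⟨star (w : A), hstar _ w.2⟩)) (by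
      simp [IsSelfAdjoint, star_smul, ← smul_neg])).1
  rw [map_add] at e1
  rw [map_smul, map_sub] at e2
  simp at e1 e2
  apply Complex.ext
  · simp; linarith
  · simp; linarith

/-- Unital positive functionals on operator systems are contractive. -/
theorem OperatorSystem.norm_apply_le {W : Submodule ℂ A} (h1 : (1 : A) ∈ W)
    (hstar : ∀ a ∈ W, star a ∈ W)
    (σ : W →ₗ[ℂ] ℂ) (hσ1 : σ ⟨1, h1⟩ = 1) (hσ : ∀ w : W, 0 ≤ (w : A) → 0 ≤ σ w) (w : W) :
    ‖σ w‖ ≤ ‖(w : A)‖ := by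
  -- Rotating by a phase makes the value nonnegative, so that it is attained on the self-adjoint
  -- part of `c • w`, where the order bound applies.
  obtain ⟨c, hc, hcw⟩ : ∃ c : ℂ, ‖c‖ = 1 ∧ c * σ w = ‖σ w‖ := by
    by_cases h : σ w = 0
    · exact ⟨1, by simp [h]⟩
    · refine ⟨(‖σ w‖ : ℂ) / σ w, ?_, ?_⟩
      · simp [h]
      · field_simp
  set v : W := c • w
  have hv : σ v = ‖σ w‖ := by rw [map_smul, smul_eq_mul, hcw]
  have hs := OperatorSystem.apply_of_isSelfAdjoint h1 σ hσ1 hσ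
    (((1 / 2 : ℝ) : ℂ) • (v + ⟨star (v : A), hstar _ v.2⟩)) (by
      simp [IsSelfAdjoint, star_smul, add_comm])
  have := hs.2
  rw [map_smul, map_add, OperatorSystem.apply_star h1 hstar σ hσ1 hσ, hv] at this
  have e : (((1 / 2 : ℝ) : ℂ) • ((‖σ w‖ : ℂ) + star (‖σ w‖ : ℂ))).re = ‖σ w‖ := by
    simp; ring
  rw [e] at this
  refine this.trans ?_
  have hvn : ‖(v : A)‖ = ‖(w : A)‖ := by simp [v, norm_smul, hc]
  calc ‖((((1 / 2 : ℝ) : ℂ) • (v + ⟨star (v : A), hstar _ v.2⟩) : W) : A)‖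
      = 1 / 2 * ‖(v : A) + star (v : A)‖ := by
        rw [Submodule.coe_smul, norm_smul]; simp
    _ ≤ 1 / 2 * (‖(v : A)‖ + ‖star (v : A)‖) := by gcongr; exact norm_add_le _ _
    _ = ‖(w : A)‖ := by rw [norm_star, hvn]; ring

/-- Contractive unital functionals on a C*-algebra are positive. -/
theorem IsUnitalPositive.of_norm_apply_le {τ : A →ₗ[ℂ] ℂ} (h1 : τ 1 = 1)
    (hτ : ∀ a, ‖τ a‖ ≤ ‖a‖) : IsUnitalPositive τ := by
  have : Nontrivial A := ⟨1, 0, fun h => by simp [h] at h1⟩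
  have hn : ‖(1 : A)‖ = 1 := CStarRing.norm_one
  refine ⟨h1, fun a ha => ?_⟩
  have hsa : IsSelfAdjoint a := .of_nonneg ha
  have him : (τ a).im = 0 := by
    -- Compare `|τ(a + it)|²` with `‖a + it‖² ≤ ‖a‖² + t²`. The terms in `t²` cancel, leaving a
    -- bound on a linear function of `t`, whose slope must vanish.
    have key : ∀ t : ℝ, (τ a).im ^ 2 + 2 * (τ a).im * t ≤ ‖a‖ ^ 2 := by
      intro t
      have e1 : ‖a + (t * I : ℂ) • (1 : A)‖ ^ 2 ≤ ‖a‖ ^ 2 + t ^ 2 := by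
        rw [sq, ← CStarRing.norm_star_mul_self]
        have : star (a + (t * I : ℂ) • (1 : A)) * (a + (t * I : ℂ) • (1 : A)) =
            a * a + ((t ^ 2 : ℝ) : ℂ) • (1 : A) := by
          have h2 : star (t * I : ℂ) = -(t * I) := by simp
          rw [star_add, star_smul, h2, hsa.star_eq, star_one]
          simp only [add_mul, mul_add, mul_smul_comm, smul_mul_assoc, mul_one, one_mul]
          have h3 : (t * I : ℂ) • ((-(t * I : ℂ)) • (1 : A)) = ((t ^ 2 : ℝ) : ℂ) • (1 : A) := by
            rw [smul_smul]; congr 1; push_cast; ring_nf; simp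
          rw [smul_add, h3]; module
        rw [this]
        refine (norm_add_le _ _).trans ?_
        rw [norm_smul, hn, mul_one]
        gcongr
        · rw [sq]; exact norm_mul_le _ _
        · simp
      have e2 : ‖τ (a + (t * I : ℂ) • (1 : A))‖ ^ 2 ≤ ‖a‖ ^ 2 + t ^ 2 :=
        le_trans (by gcongr; exact hτ _) e1
      rw [map_add, map_smul, h1, ← Complex.normSq_eq_norm_sq, Complex.normSq_apply] at e2
      simp at e2
      nlinarith [sq_nonneg (τ a).re]
    by_contra hne
    have := key ((‖a‖ ^ 2 + 1) / (2 * (τ a).im))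
    field_simp at this
    nlinarith [sq_nonneg (τ a).im]
  have hre : 0 ≤ (τ a).re := by
    -- From `0 ≤ a ≤ ‖a‖` the element `‖a‖ - a` has norm at most `‖a‖`, so `|‖a‖ - τ a| ≤ ‖a‖`,
    -- which excludes a negative `τ a`.
    have hle : ‖((‖a‖ : ℝ) : ℂ) • (1 : A) - a‖ ≤ ‖a‖ := by
      have h := hsa.le_algebraMap_norm_self
      rw [Algebra.algebraMap_eq_smul_one] at h
      refine ((CStarAlgebra.mem_Icc_algebraMap_iff_norm_le (norm_nonneg a)).1 ⟨?_, ?_⟩).2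
      · simpa using h
      · rw [Algebra.algebraMap_eq_smul_one]
        simpa using ha
    have h2 := (hτ _).trans hle
    rw [map_sub, map_smul, h1] at h2
    have h3 := (Complex.abs_re_le_norm _).trans h2
    simp at h3
    have := (abs_le.1 h3).2
    linarith
  exact Complex.nonneg_iff.2 ⟨hre, him.symm⟩

/-- A contractive unital functional on a subspace extends to a state. -/
theorem exists_state_extension {W : Submodule ℂ A} (h1 : (1 : A) ∈ W) (σ : W →ₗ[ℂ] ℂ)
    (hσ1 : σ ⟨1, h1⟩ = 1) (hσ : ∀ w : W, ‖σ w‖ ≤ ‖(w : A)‖) :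
    ∃ τ : A →ₗ[ℂ] ℂ, IsUnitalPositive τ ∧ ∀ w : W, τ w = σ w := by
  let σ' : StrongDual ℂ W := σ.mkContinuous 1 (fun w => by simpa using hσ w)
  obtain ⟨g, hg, hgn⟩ := exists_extension_norm_eq W σ'
  have hn : ‖g‖ ≤ 1 := hgn ▸ σ.mkContinuous_norm_le zero_le_one _
  refine ⟨g.toLinearMap, .of_norm_apply_le ?_ fun a => ?_, fun w => hg w⟩
  · exact (hg ⟨1, h1⟩).trans hσ1
  · simpa using g.le_of_opNorm_le hn a

namespace IsUnitalPositive

variable {τ : A →ₗ[ℂ] ℂ}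

theorem apply_star (hτ : IsUnitalPositive τ) (a : A) : τ (star a) = star (τ a) :=
  OperatorSystem.apply_star (W := ⊤) trivial (fun _ _ => trivial) (τ ∘ₗ Submodule.subtype ⊤)
    hτ.map_one (fun _ hw => hτ.map_nonneg _ hw) ⟨a, trivial⟩

theorem norm_apply_le (hτ : IsUnitalPositive τ) (a : A) : ‖τ a‖ ≤ ‖a‖ :=
  OperatorSystem.norm_apply_le (W := ⊤) trivial (fun _ _ => trivial) (τ ∘ₗ Submodule.subtype ⊤)
    hτ.map_one (fun _ hw => hτ.map_nonneg _ hw) ⟨a, trivial⟩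

theorem im_apply_eq_zero (hτ : IsUnitalPositive τ) {a : A} (ha : IsSelfAdjoint a) :
    (τ a).im = 0 := by
  have := hτ.apply_star a
  rw [ha.star_eq] at this
  exact Complex.conj_eq_iff_im.1 this.symm

theorem continuous (hτ : IsUnitalPositive τ) : Continuous τ :=
  (τ.mkContinuous 1 (fun a => by simpa using hτ.norm_apply_le a)).continuous

/-- Kadison's inequality for states. -/
theorem sq_apply_le (hτ : IsUnitalPositive τ) {a : A} (ha : IsSelfAdjoint a) :
    τ a ^ 2 ≤ τ (a * a) := by
  set c : ℂ := τ a
  have hc : star c = c := by rw [← hτ.apply_star, ha.star_eq]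
  have h := hτ.map_nonneg _ (star_mul_self_nonneg (a - c • (1 : A)))
  have e : star (a - c • (1 : A)) * (a - c • (1 : A)) = a * a - (2 * c) • a + (c ^ 2) • (1 : A) := by
    rw [star_sub, star_smul, hc, ha.star_eq, star_one]
    simp only [sub_mul, mul_sub, mul_smul_comm, smul_mul_assoc, mul_one, one_mul]
    rw [sq]; module
  rw [e, map_add, map_sub, map_smul, map_smul, hτ.map_one] at h
  have e2 : τ (a * a) - (2 * c) • τ a + c ^ 2 • (1 : ℂ) = τ (a * a) - c ^ 2 := by
    simp only [smul_eq_mul]; change _ - 2 * c * c + _ = _; ring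
  rw [e2] at h
  exact sub_nonneg.1 h

end IsUnitalPositive

/-- States converge pointwise along ultrafilters. -/
theorem exists_state_tendsto {ι : Type*} (F : Ultrafilter ι) (τ : ι → A →ₗ[ℂ] ℂ)
    (hτ : ∀ i, IsUnitalPositive (τ i)) :
    ∃ σ : A →ₗ[ℂ] ℂ, IsUnitalPositive σ ∧ ∀ a, Tendsto (fun i => τ i a) F (𝓝 (σ a)) := by
  have h : ∀ a, ∃ z, Tendsto (fun i => τ i a) F (𝓝 z) := by
    intro a
    obtain ⟨z, -, hz⟩ := (isCompact_closedBall (0 : ℂ) ‖a‖).ultrafilter_le_nhds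
      (F.map fun i => τ i a) (by
        rw [le_principal_iff]
        refine Filter.mem_map.2 (Filter.univ_mem' fun i => ?_)
        simpa using (hτ i).norm_apply_le a)
    exact ⟨z, hz⟩
  choose σ hσ using h
  refine ⟨{ toFun := σ, map_add' := fun a b => ?_, map_smul' := fun c a => ?_ }, ⟨?_, ?_⟩, hσ⟩
  · refine tendsto_nhds_unique (hσ (a + b)) ?_
    simpa using (hσ a).add (hσ b)
  · refine tendsto_nhds_unique (hσ (c • a)) ?_
    simpa using (hσ a).const_mul c
  · refine tendsto_nhds_unique (hσ 1) ?_
    simp [fun i => (hτ i).map_one]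
  · intro a ha
    exact ge_of_tendsto' (hσ a) fun i => (hτ i).map_nonneg a ha

end States

/-! ### Matrices over C*-algebras -/

/-- Positivity can be checked on a jointly injective family of *-homomorphisms. -/
theorem CStarAlgebra.nonneg_of_forall_map_nonneg {ι : Type*} {B D : Type*} [CStarAlgebra B]
    [PartialOrder B] [StarOrderedRing B] [CStarAlgebra D] [PartialOrder D] [StarOrderedRing D]
    (ev : ι → B →⋆ₙₐ[ℂ] D) (hinj : ∀ b, (∀ x, ev x b = 0) → b = 0) {b : B}
    (h : ∀ x, 0 ≤ ev x b) : 0 ≤ b := by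
  have hsa : IsSelfAdjoint b := by
    rw [IsSelfAdjoint, ← sub_eq_zero]
    refine hinj _ fun x => ?_
    rw [map_sub, map_star, sub_eq_zero]
    exact (IsSelfAdjoint.of_nonneg (h x)).star_eq
  -- With `q` the image of `b⁻`, compressing the positive image of `b` by `q` gives `-q³`, while `q³
  -- ≥ 0`. Hence `q³ = 0`, and `q = 0` by the C*-identity.
  have hneg : b⁻ = 0 := by
    refine hinj _ fun x => ?_
    set p := ev x b⁺
    set q := ev x b⁻ with hqdef
    have hq : 0 ≤ q := map_nonneg (ev x) (CFC.negPart_nonneg b)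
    have hpq : p * q = 0 := by
      rw [← map_mul, CFC.posPart_mul_negPart, map_zero]
    have hM : ev x b = p - q := by
      rw [← map_sub, CFC.posPart_sub_negPart b hsa]
    have hqsa := IsSelfAdjoint.of_nonneg hq
    have h1 : 0 ≤ q * ev x b * q := by
      simpa [hqsa.star_eq] using star_left_conjugate_nonneg (h x) q
    have h2 : q * ev x b * q = -(q * q * q) := by
      rw [hM, mul_sub, sub_mul, mul_assoc, hpq]; simp
    have h3 : 0 ≤ q * q * q := by
      simpa [hqsa.star_eq] using star_left_conjugate_nonneg hq q
    have h4 : q * q * q = 0 := by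
      rw [h2] at h1
      exact le_antisymm (neg_nonneg.1 h1) h3
    have h5 : q * q = 0 := by
      rw [← CStarRing.star_mul_self_eq_zero_iff, star_mul, hqsa.star_eq, ← mul_assoc, h4, zero_mul]
    rw [← CStarRing.star_mul_self_eq_zero_iff, hqsa.star_eq, h5]
  rw [← CFC.posPart_sub_negPart b hsa, hneg, sub_zero]
  exact CFC.posPart_nonneg b

theorem CStarAlgebra.exists_eq_star_mul_self {B : Type*} [CStarAlgebra B] [PartialOrder B]
    [StarOrderedRing B] {b : B} (hb : 0 ≤ b) : ∃ d, b = star d * d :=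
  CStarAlgebra.nonneg_iff_eq_star_mul_self.1 hb

namespace CStarMatrix

/-! ### Norms as positivity of two-by-two block matrices -/

section Blocks

variable {A : Type*} [CStarAlgebra A] {n : Type*}

/-- The matrix with the four given blocks. -/
def ofBlocks {A : Type*} (a b c d : CStarMatrix n n A) : CStarMatrix (n ⊕ n) (n ⊕ n) A :=
  ofMatrix (Matrix.fromBlocks (ofMatrix.symm a) (ofMatrix.symm b) (ofMatrix.symm c)
    (ofMatrix.symm d))

theorem ofBlocks_mul [Fintype n] (a b c d a' b' c' d' : CStarMatrix n n A) :
    ofBlocks a b c d * ofBlocks a' b' c' d' =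
      ofBlocks (a * a' + b * c') (a * b' + b * d') (c * a' + d * c') (c * b' + d * d') :=
  Matrix.fromBlocks_multiply _ _ _ _ _ _ _ _

theorem star_ofBlocks (a b c d : CStarMatrix n n A) :
    star (ofBlocks a b c d) = ofBlocks (star a) (star c) (star b) (star d) :=
  Matrix.fromBlocks_conjTranspose _ _ _ _

variable [PartialOrder A] [StarOrderedRing A] [Fintype n] [DecidableEq n]

/-- A Cholesky factorization: if `1 - a* a = d* d`, the block matrix is `T* T` with `T` upper
triangular with rows `(1, a)` and `(0, d)`. -/
theorem ofBlocks_nonneg_of_norm_le_one {a : CStarMatrix n n A} (ha : ‖a‖ ≤ 1) :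
    0 ≤ ofBlocks 1 a (star a) 1 := by
  have h : 0 ≤ 1 - star a * a := by
    have h1 := CStarAlgebra.star_mul_le_algebraMap_norm_sq (a := a)
    have h2 : algebraMap ℝ (CStarMatrix n n A) (‖a‖ ^ 2) ≤ algebraMap ℝ _ 1 := by
      gcongr
      nlinarith [norm_nonneg a]
    simpa using h1.trans h2
  obtain ⟨d, hd⟩ := CStarAlgebra.exists_eq_star_mul_self h
  have : ofBlocks 1 a (star a) 1 = star (ofBlocks 1 a 0 d) * ofBlocks 1 a 0 d := by
    rw [star_ofBlocks, ofBlocks_mul]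
    simp [← hd]
  rw [this]
  exact star_mul_self_nonneg _

/-- Compressing by the column `(-a, 1)` leaves `1 - a* a` in the lower right corner. The corner is
seen to be positive by factoring the whole matrix as `e* e` and reading off that block. -/
theorem norm_le_one_of_ofBlocks_nonneg {a b : CStarMatrix n n A}
    (h : 0 ≤ ofBlocks 1 a b 1) : ‖a‖ ≤ 1 := by
  have hb : b = star a := by
    have := (IsSelfAdjoint.of_nonneg h).star_eq
    rw [star_ofBlocks] at this
    have h2 := (Matrix.fromBlocks_inj.1 this).2.2.1
    exact h2.symm
  subst hb
  have h1 := star_left_conjugate_nonneg h (ofBlocks 0 (-a) 0 1)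
  rw [star_ofBlocks, ofBlocks_mul, ofBlocks_mul] at h1
  obtain ⟨e, he⟩ := CStarAlgebra.exists_eq_star_mul_self h1
  obtain ⟨p, q, r, s, rfl⟩ : ∃ p q r s, e = ofBlocks p q r s :=
    ⟨_, _, _, _, (Matrix.fromBlocks_toBlocks e).symm⟩
  rw [star_ofBlocks, ofBlocks_mul] at he
  have h3 := (Matrix.fromBlocks_inj.1 he).2.2.2
  change _ = star q * q + star s * s at h3
  have h4 : 0 ≤ 1 - star a * a := by
    have : 0 ≤ star q * q + star s * s :=
      add_nonneg (star_mul_self_nonneg q) (star_mul_self_nonneg s)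
    rw [← h3] at this
    change 0 ≤ (star (-a) * 1 + star 1 * star a) * -a + (star (-a) * a + star 1 * 1) * 1 at this
    simpa [sub_eq_add_neg, add_comm] using this
  have h5 : ‖star a * a‖ ≤ 1 :=
    (CStarAlgebra.norm_le_one_iff_of_nonneg _ (star_mul_self_nonneg a)).2 (sub_nonneg.1 h4)
  rw [CStarRing.norm_star_mul_self] at h5
  nlinarith [norm_nonneg a]

end Blocks

/-! ### Positivity of matrices of scalars and of continuous functions -/

section CommutativeTarget

variable {n : Type*} [Fintype n] [DecidableEq n]

theorem nonneg_of_posSemidef {M : CStarMatrix n n ℂ} (h : (ofMatrix.symm M).PosSemidef) :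
    0 ≤ M := by
  open scoped MatrixOrder in
  obtain ⟨B, hB⟩ := CStarAlgebra.nonneg_iff_eq_star_mul_self.1 h.nonneg
  have : M = star (ofMatrix B) * ofMatrix B := hB
  rw [this]
  exact star_mul_self_nonneg _

variable {X : Type*} [TopologicalSpace X] [CompactSpace X]

/-- A matrix of continuous functions is positive if it is pointwise positive. -/
theorem nonneg_of_forall_eval {M : CStarMatrix n n C(X, ℂ)}
    (h : ∀ x, 0 ≤ M.map (fun f => f x)) : 0 ≤ M := by
  let ev : X → CStarMatrix n n C(X, ℂ) →⋆ₙₐ[ℂ] CStarMatrix n n ℂ := fun x =>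
    mapₙₐ (ContinuousMap.evalStarAlgHom ℂ ℂ x : C(X, ℂ) →⋆ₙₐ[ℂ] ℂ)
  refine CStarAlgebra.nonneg_of_forall_map_nonneg ev (fun N hN => ?_) h
  ext i j x
  exact congrFun (congrFun (hN x) i) j

end CommutativeTarget

/-! ### Automatic complete positivity and complete contractivity -/

section OperatorSystems

variable {A : Type*} [CStarAlgebra A] [PartialOrder A] [StarOrderedRing A] {W : Submodule ℂ A}
variable {n : Type*} [Fintype n] [DecidableEq n]

/-- For `M = E* E` the sum is `∑ k, (E c)ₖ* (E c)ₖ`. It turns positivity of a matrix into positivity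
of single elements, which is all a positive map can see. -/
theorem sum_star_mul_nonneg {M : CStarMatrix n n A} (hM : 0 ≤ M) (c : n → ℂ) :
    0 ≤ ∑ i, ∑ j, (star (c i) * c j) • M i j := by
  obtain ⟨E, rfl⟩ := CStarAlgebra.exists_eq_star_mul_self hM
  have : ∑ i, ∑ j, (star (c i) * c j) • (star E * E) i j =
      ∑ k, star (∑ i, c i • E k i) * ∑ j, c j • E k j := by
    simp only [mul_apply, star_apply, star_sum, star_smul, Finset.smul_sum, Finset.sum_mul_sum,
      smul_mul_smul_comm]
    rw [Finset.sum_comm' (t' := Finset.univ) (s' := fun _ => Finset.univ) (by simp)]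
    rw [← Finset.sum_comm]
    conv_rhs => rw [Finset.sum_comm]
    refine Finset.sum_congr rfl fun i _ => ?_
    rw [Finset.sum_comm]
  rw [this]
  exact Finset.sum_nonneg fun k _ => star_mul_self_nonneg _

/-- Unital positive maps from an operator system to a commutative C*-algebra are completely
positive. -/
theorem map_nonneg_of_positive {X : Type*} [TopologicalSpace X] [CompactSpace X]
    (h1 : (1 : A) ∈ W) (hstar : ∀ a ∈ W, star a ∈ W) (φ : W →ₗ[ℂ] C(X, ℂ))
    (hφ1 : φ ⟨1, h1⟩ = 1) (hφ : ∀ w : W, 0 ≤ (w : A) → 0 ≤ φ w) (M : CStarMatrix n n W)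
    (hM : 0 ≤ M.map (fun w => (w : A))) : 0 ≤ M.map φ := by
  refine nonneg_of_forall_eval fun x => nonneg_of_posSemidef ?_
  let σ : W →ₗ[ℂ] ℂ := (ContinuousMap.evalCLM ℂ x).toLinearMap ∘ₗ φ
  have hσ1 : σ ⟨1, h1⟩ = 1 := congrFun (congrArg DFunLike.coe hφ1) x
  have hσ : ∀ w : W, 0 ≤ (w : A) → 0 ≤ σ w := fun w hw => hφ w hw x
  refine .of_dotProduct_mulVec_nonneg ?_ fun c => ?_
  · ext i j
    have h := (IsSelfAdjoint.of_nonneg hM).star_eq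
    have hij : star (M j i : A) = M i j := congrFun (congrFun h i) j
    have := OperatorSystem.apply_star h1 hstar σ hσ1 hσ (M j i)
    change star (σ (M j i)) = σ (M i j)
    rw [← this]
    congr 1
    exact Subtype.ext hij
  · have := hσ (∑ i, ∑ j, (star (c i) * c j) • M i j) (by
      simpa using! sum_star_mul_nonneg hM c)
    simp only [map_sum, map_smul] at this
    convert this using 1
    simp only [dotProduct, Matrix.mulVec, Finset.mul_sum]
    refine Finset.sum_congr rfl fun i _ => Finset.sum_congr rfl fun j _ => ?_
    change star (c i) * (σ (M i j) * c j) = _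
    rw [smul_eq_mul]; ring

variable {B : Type*} [CStarAlgebra B] [PartialOrder B] [StarOrderedRing B] {V : Submodule ℂ B}

/-- Unital completely positive maps of operator systems are completely contractive. -/
theorem norm_map_le_of_completelyPositive (h1 : (1 : A) ∈ W) (hstar : ∀ a ∈ W, star a ∈ W)
    (h1' : (1 : B) ∈ V) (φ : W →ₗ[ℂ] V) (hφ1 : φ ⟨1, h1⟩ = ⟨1, h1'⟩)
    (hφ : ∀ (k : ℕ) (M : CStarMatrix (Fin k) (Fin k) W), 0 ≤ M.map (fun w => (w : A)) →
      0 ≤ M.map (fun w => (φ w : B))) (k : ℕ) (M : CStarMatrix (Fin k) (Fin k) W) :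
    ‖M.map (fun w => (φ w : B))‖ ≤ ‖M.map (fun w => (w : A))‖ := by
  have key : ∀ M : CStarMatrix (Fin k) (Fin k) W, ‖M.map (fun w => (w : A))‖ ≤ 1 →
      ‖M.map (fun w => (φ w : B))‖ ≤ 1 := by
    intro M hM
    let e : CStarMatrix (Fin k) (Fin k) W := fun i j => if i = j then ⟨1, h1⟩ else 0
    let M' : CStarMatrix (Fin k) (Fin k) W := fun i j => ⟨star (M j i : A), hstar _ (M j i).2⟩
    -- Paulsen's trick: a contraction `M` is encoded by the positive block matrix with rows `(1, M)`
    -- and `(M*, 1)`, whose image under `φ` is positive with unit diagonal blocks.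
    let N : CStarMatrix (Fin k ⊕ Fin k) (Fin k ⊕ Fin k) W := ofBlocks e M M' e
    have hN : 0 ≤ N.map (fun w => (w : A)) := by
      convert ofBlocks_nonneg_of_norm_le_one hM using 1
      ext i j
      rcases i with i | i <;> rcases j with j | j
      · change ((if i = j then (⟨1, h1⟩ : W) else 0 : W) : A) = (1 : CStarMatrix _ _ A) i j
        rw [one_apply]; split_ifs <;> rfl
      · rfl
      · rfl
      · change ((if i = j then (⟨1, h1⟩ : W) else 0 : W) : A) = (1 : CStarMatrix _ _ A) i j
        rw [one_apply]; split_ifs <;> rfl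
    -- Complete positivity is assumed for index types `Fin k` only, so the block index is identified
    -- with `Fin (k + k)` and back.
    have hN2 : 0 ≤ N.map (fun w => (φ w : B)) := by
      have h2 := hφ (k + k) (fun i j => N (finSumFinEquiv.symm i) (finSumFinEquiv.symm j)) (by
        exact map_nonneg (reindexₐ ℂ A finSumFinEquiv) hN)
      have h3 := map_nonneg (reindexₐ ℂ B finSumFinEquiv.symm) h2
      convert h3 using 1
      ext i j
      change (φ (N i j) : B) = (φ (N (finSumFinEquiv.symm (finSumFinEquiv i))
        (finSumFinEquiv.symm (finSumFinEquiv j))) : B)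
      simp
    refine norm_le_one_of_ofBlocks_nonneg (b := M'.map (fun w => (φ w : B))) ?_
    convert hN2 using 1
    ext i j
    rcases i with i | i <;> rcases j with j | j
    · change (1 : CStarMatrix _ _ B) i j = φ (if i = j then (⟨1, h1⟩ : W) else 0 : W)
      rw [one_apply]; split_ifs
      · rw [hφ1]
      · simp
    · rfl
    · rfl
    · change (1 : CStarMatrix _ _ B) i j = φ (if i = j then (⟨1, h1⟩ : W) else 0 : W)
      rw [one_apply]; split_ifs
      · rw [hφ1]
      · simp
  -- Scaling by some `r` above the norm, rather than by the norm itself, avoids dividing by zero.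
  refine le_of_forall_gt_imp_ge_of_dense fun r hr => ?_
  have hr0 : 0 < r := (norm_nonneg _).trans_lt hr
  have hsmul1 : ((r⁻¹ : ℝ) : ℂ) • M.map (fun w => (w : A)) =
      (((r⁻¹ : ℝ) : ℂ) • M).map (fun w => (w : A)) := rfl
  have hsmul2 : ((r⁻¹ : ℝ) : ℂ) • M.map (fun w => (φ w : B)) =
      (((r⁻¹ : ℝ) : ℂ) • M).map (fun w => (φ w : B)) := by
    ext i j; simp
  have h := key (((r⁻¹ : ℝ) : ℂ) • M) (by
    rw [← hsmul1, norm_smul]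
    simp only [Complex.norm_real, norm_inv, Real.norm_eq_abs, abs_of_pos hr0]
    rw [inv_mul_le_iff₀ hr0]
    linarith)
  rw [← hsmul2, norm_smul] at h
  simp only [Complex.norm_real, norm_inv, Real.norm_eq_abs, abs_of_pos hr0] at h
  rw [inv_mul_le_iff₀ hr0] at h
  linarith

/-- The embedding of `A` as `1 × 1` matrices. -/
def oneByOne (A : Type*) [CStarAlgebra A] : A →⋆ₙₐ[ℂ] CStarMatrix (Fin 1) (Fin 1) A where
  toFun a := ofMatrix fun _ _ => a
  map_smul' _ _ := rfl
  map_zero' := rfl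
  map_add' _ _ := rfl
  map_mul' a b := by
    ext i j
    rw [mul_apply]
    simp
    rfl
  map_star' _ := rfl

/-- The entry of a `1 × 1` matrix. -/
def oneByOneEntry (A : Type*) [CStarAlgebra A] : CStarMatrix (Fin 1) (Fin 1) A →⋆ₙₐ[ℂ] A where
  toFun M := M 0 0
  map_smul' _ _ := rfl
  map_zero' := rfl
  map_add' _ _ := rfl
  map_mul' _ _ := by simp [mul_apply]
  map_star' _ := rfl

/-- Injective *-homomorphisms of C*-algebras are isometric. -/
theorem norm_map_one_by_one {R : Type*} (a : R) (f : R → A) :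
    ‖CStarMatrix.map (fun _ _ => a : CStarMatrix (Fin 1) (Fin 1) R) f‖ = ‖f a‖ :=
  NonUnitalStarAlgHom.norm_map (B := CStarMatrix (Fin 1) (Fin 1) A) (oneByOne A)
    (fun _ _ h => congrFun (congrFun h 0) 0) (f a)

theorem map_one_by_one_nonneg_iff {R : Type*} (a : R) (f : R → A) :
    0 ≤ CStarMatrix.map (fun _ _ => a : CStarMatrix (Fin 1) (Fin 1) R) f ↔ 0 ≤ f a :=
  ⟨fun h => map_nonneg (oneByOneEntry A) h, fun h => map_nonneg (oneByOne A) h⟩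

end OperatorSystems

end CStarMatrix

/-! ### `ℓ^∞(G)` as an ordered C*-algebra, and equivariant maps -/

namespace EllInfty

variable {G : Type u}

theorem ext {f g : EllInfty G} (h : ∀ t, f t = g t) : f = g :=
  lp.ext (funext h)

/-- The pointwise order. -/
instance : PartialOrder (EllInfty G) :=
  PartialOrder.lift (fun f => (f : G → ℂ)) fun _ _ h => lp.ext h

instance : StarOrderedRing (EllInfty G) :=
  StarOrderedRing.of_nonneg_iff' (fun {_ _} h z t => add_le_add_right (h t) (z t)) fun f => by
    constructor
    · intro h
      obtain ⟨C, hC⟩ := memℓp_infty_iff.1 (lp.memℓp f)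
      refine ⟨⟨fun t => (Real.sqrt (f t).re : ℂ), memℓp_infty ⟨Real.sqrt C, ?_⟩⟩, ?_⟩
      · rintro _ ⟨t, rfl⟩
        have := hC ⟨t, rfl⟩
        simp only [Complex.norm_real, Real.norm_eq_abs, abs_of_nonneg (Real.sqrt_nonneg _)]
        exact Real.sqrt_le_sqrt ((Complex.re_le_norm _).trans this)
      · refine ext fun t => ?_
        have ht := Complex.nonneg_iff.1 (h t)
        change f t = star (Real.sqrt (f t).re : ℂ) * (Real.sqrt (f t).re : ℂ)
        have : (f t) = ((f t).re : ℂ) := Complex.ext rfl (by simp [← ht.2])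
        rw [Complex.star_def, Complex.conj_ofReal, ← Complex.ofReal_mul, Real.mul_self_sqrt ht.1]
        exact this
    · rintro ⟨s, rfl⟩ t
      exact star_mul_self_nonneg (s t)

/-- Evaluation at a point, as a linear functional. -/
def eval (t : G) : EllInfty G →ₗ[ℂ] ℂ where
  toFun f := f t
  map_add' _ _ := rfl
  map_smul' _ _ := rfl

@[simp] theorem eval_apply (t : G) (f : EllInfty G) : eval t f = f t := rfl

theorem isUnitalPositive_eval (t : G) : IsUnitalPositive (eval t) := ⟨rfl, fun _ h => h t⟩

/-- The map into `ℓ^∞(G)` defined by a pointwise bounded family of functionals. -/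
def ofFamily {V : Type*} [AddCommGroup V] [Module ℂ V] (F : G → V →ₗ[ℂ] ℂ)
    (hF : ∀ x, ∃ C, ∀ t, ‖F t x‖ ≤ C) : V →ₗ[ℂ] EllInfty G where
  toFun x := ⟨fun t => F t x, memℓp_infty (by
    obtain ⟨C, hC⟩ := hF x
    refine ⟨C, ?_⟩
    rintro _ ⟨t, rfl⟩
    exact hC t)⟩
  map_add' x y := ext fun t => (F t).map_add x y
  map_smul' c x := ext fun t => (F t).map_smul c x

@[simp] theorem ofFamily_apply {V : Type*} [AddCommGroup V] [Module ℂ V] (F : G → V →ₗ[ℂ] ℂ)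
    (hF : ∀ x, ∃ C, ∀ t, ‖F t x‖ ≤ C) (x : V) (t : G) : ofFamily F hF x t = F t x := rfl

variable [Group G]

@[simp] theorem translate_apply (s : G) (f : EllInfty G) (t : G) :
    translate s f t = f (s⁻¹ * t) := rfl

end EllInfty

/-- Algebras on which `G` acts by translations. -/
class HasTranslation (G : Type u) (A : Type v) where
  tr : G → A → A

open HasTranslation


instance (G : Type u) [Group G] : HasTranslation G (EllInfty G) := ⟨EllInfty.translate⟩

section

variable (G : Type u) [Group G]

instance (X : Type v) [TopologicalSpace X] [CompactSpace X] [MulAction G X]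
    [ContinuousConstSMul G X] : HasTranslation G C(X, ℂ) :=
  ⟨fun s => GOperatorSystem.translate X s⟩

theorem EllInfty.tr_apply (s : G) (f : EllInfty G) (t : G) : tr s f t = f (s⁻¹ * t) := rfl

theorem ContinuousMap.tr_apply {G : Type u} [Group G] {X : Type v} [TopologicalSpace X]
    [CompactSpace X] [MulAction G X]
    [ContinuousConstSMul G X] (s : G) (f : C(X, ℂ)) (x : X) : tr s f x = f (s⁻¹ • x) := rfl

/-- Unital positive `G`-equivariant maps. -/
structure IsGMap {A B : Type*} [Semiring A] [PartialOrder A] [Module ℂ A]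
    [Semiring B] [PartialOrder B] [Module ℂ B] [HasTranslation G A] [HasTranslation G B]
    (φ : A →ₗ[ℂ] B) : Prop extends IsUnitalPositive φ where
  equivariant : ∀ (s : G) (a : A), φ (tr s a) = tr s (φ a)

variable {G}

theorem IsUnitalPositive.comp {A B C : Type*} [Semiring A] [PartialOrder A] [Module ℂ A]
    [Semiring B] [PartialOrder B] [Module ℂ B] [Semiring C] [PartialOrder C] [Module ℂ C]
    {ψ : B →ₗ[ℂ] C} {φ : A →ₗ[ℂ] B} (hψ : IsUnitalPositive ψ) (hφ : IsUnitalPositive φ) :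
    IsUnitalPositive (ψ ∘ₗ φ) :=
  ⟨by simp [hφ.map_one, hψ.map_one], fun a ha => hψ.map_nonneg _ (hφ.map_nonneg a ha)⟩

theorem IsGMap.comp {G : Type u} {A B C : Type*} [Semiring A] [PartialOrder A] [Module ℂ A]
    [Semiring B] [PartialOrder B] [Module ℂ B] [Semiring C] [PartialOrder C] [Module ℂ C]
    [HasTranslation G A] [HasTranslation G B] [HasTranslation G C]
    {ψ : B →ₗ[ℂ] C} {φ : A →ₗ[ℂ] B} (hψ : IsGMap G ψ) (hφ : IsGMap G φ) :
    IsGMap G (ψ ∘ₗ φ) :=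
  ⟨hψ.toIsUnitalPositive.comp hφ.toIsUnitalPositive, fun s a => by
    simp [hφ.equivariant, hψ.equivariant]⟩

/-- Evaluation at a point, as a linear functional. -/
def ContinuousMap.evalₗ {X : Type v} [TopologicalSpace X] (x : X) : C(X, ℂ) →ₗ[ℂ] ℂ where
  toFun f := f x
  map_add' _ _ := rfl
  map_smul' _ _ := rfl

@[simp] theorem ContinuousMap.evalₗ_apply {X : Type v} [TopologicalSpace X] (x : X) (f : C(X, ℂ)) :
    ContinuousMap.evalₗ x f = f x := rfl

theorem ContinuousMap.isUnitalPositive_evalₗ {X : Type v} [TopologicalSpace X] (x : X) :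
    IsUnitalPositive (ContinuousMap.evalₗ x) := ⟨rfl, fun _ h => h x⟩

variable {X : Type v} [TopologicalSpace X] [CompactSpace X] [MulAction G X]

/-- The restriction of functions to the orbit of `x`. -/
def orbitHom (x : X) : C(X, ℂ) →⋆ₐ[ℂ] EllInfty G where
  toFun f := EllInfty.ofFamily (fun t : G => ContinuousMap.evalₗ (t • x))
    (fun f => ⟨‖f‖, fun _ => f.norm_coe_le_norm _⟩) f
  map_one' := rfl
  map_mul' _ _ := rfl
  map_zero' := rfl
  map_add' _ _ := rfl
  commutes' _ := rfl
  map_star' _ := rfl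

@[simp] theorem orbitHom_apply (x : X) (f : C(X, ℂ)) (t : G) :
    orbitHom (G := G) x f t = f (t • x) := rfl

theorem isGMap_orbitHom [ContinuousConstSMul G X] (x : X) : IsGMap G (orbitHom (G := G) x).toLinearMap where
  map_one := rfl
  map_nonneg _ h t := h (t • x)
  equivariant s f := EllInfty.ext fun t => by
    change f (s⁻¹ • t • x) = f ((s⁻¹ * t) • x)
    rw [mul_smul]

theorem ContinuousMap.eq_of_forall_apply_eq {X : Type v} [TopologicalSpace X] [CompactSpace X]
    [T2Space X] {x y : X} (h : ∀ f : C(X, ℂ), f x = f y) : x = y := by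
  by_contra hne
  obtain ⟨f, hfx, hfy, -⟩ := exists_continuous_zero_one_of_isClosed (isClosed_singleton (x := x))
    (isClosed_singleton (x := y)) (by simpa using hne)
  have := h (ContinuousMap.comp ⟨Complex.ofReal, Complex.continuous_ofReal⟩ f)
  simp [hfx rfl, hfy rfl] at this

end

/-! ### Strong proximality in terms of states -/

section Riesz

open MeasureTheory Filter Topology

/-- A real continuous function, as a complex one. -/
def ContinuousMap.toComplex {X : Type v} [TopologicalSpace X] (f : C(X, ℝ)) : C(X, ℂ) :=
  ContinuousMap.comp ⟨Complex.ofReal, Complex.continuous_ofReal⟩ f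

@[simp] theorem ContinuousMap.toComplex_apply {X : Type v} [TopologicalSpace X] (f : C(X, ℝ))
    (x : X) : f.toComplex x = (f x : ℂ) := rfl

theorem ContinuousMap.isSelfAdjoint_toComplex {X : Type v} [TopologicalSpace X] (f : C(X, ℝ)) :
    IsSelfAdjoint f.toComplex := by
  ext x; simp

theorem ContinuousMap.eq_toComplex_add {X : Type v} [TopologicalSpace X] (f : C(X, ℂ)) :
    f = (ContinuousMap.comp ⟨Complex.re, Complex.continuous_re⟩ f).toComplex +
      Complex.I • (ContinuousMap.comp ⟨Complex.im, Complex.continuous_im⟩ f).toComplex := by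
  ext x
  simp [mul_comm Complex.I, Complex.re_add_im]

/-- Every state on `C(X)` is integration against a regular Borel probability measure. -/
theorem IsUnitalPositive.exists_measure {X : Type v} [TopologicalSpace X] [CompactSpace X]
    [T2Space X] [MeasurableSpace X] [BorelSpace X] {τ : C(X, ℂ) →ₗ[ℂ] ℂ}
    (hτ : IsUnitalPositive τ) :
    ∃ μ : Measure X, IsProbabilityMeasure μ ∧ μ.Regular ∧
      ∀ f : C(X, ℝ), τ f.toComplex = ((∫ x, f x ∂μ : ℝ) : ℂ) := by
  let Λ : CompactlySupportedContinuousMap X ℝ →ₚ[ℝ] ℝ :=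
    { toFun := fun g => (τ g.toContinuousMap.toComplex).re
      map_add' := fun g h => by
        rw [← Complex.add_re, ← map_add]
        congr 2
        ext x; simp
      map_smul' := fun c g => by
        have : (c • g).toContinuousMap.toComplex = (c : ℂ) • g.toContinuousMap.toComplex := by
          ext x; simp
        rw [this, map_smul]
        simp
      monotone' := fun g h hgh => by
        have h1 := hτ.map_nonneg (h.toContinuousMap.toComplex - g.toContinuousMap.toComplex)
          (by
            intro x
            have := hgh x
            simpa using this)
        rw [map_sub] at h1
        have h2 := (Complex.nonneg_iff.1 h1).1
        rw [Complex.sub_re] at h2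
        exact sub_nonneg.1 h2 }
  have hint : ∀ f : C(X, ℝ), ∫ x, f x ∂(RealRMK.rieszMeasure Λ) = (τ f.toComplex).re := fun f =>
    RealRMK.integral_rieszMeasure Λ ⟨f, HasCompactSupport.of_compactSpace _⟩
  refine ⟨RealRMK.rieszMeasure Λ, ⟨?_⟩, inferInstance, fun f => ?_⟩
  · have h1 := hint 1
    have h2 : (1 : C(X, ℝ)).toComplex = 1 := by ext x; simp
    rw [h2, hτ.map_one] at h1
    simpa [Measure.real, ENNReal.toReal_eq_one_iff] using h1
  · rw [hint f]
    exact Complex.ext rfl (by simpa using hτ.im_apply_eq_zero f.isSelfAdjoint_toComplex)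

variable (G : Type u) [Group G] (X : Type v) [TopologicalSpace X] [CompactSpace X] [MulAction G X]
  [ContinuousConstSMul G X]

/-- Strong proximality, in terms of states: the weak* closure of the orbit of every state on `C(X)`
contains an evaluation. -/
def IsStateProximal : Prop :=
  ∀ τ : C(X, ℂ) →ₗ[ℂ] ℂ, IsUnitalPositive τ → ∃ (x : X) (F : Ultrafilter G),
    ∀ f : C(X, ℂ), Tendsto (fun s : G => τ (tr s⁻¹ f)) F (𝓝 (f x))

variable {G X}

theorem tr_toComplex (s : G) (f : C(X, ℝ)) : tr s⁻¹ f.toComplex =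
    (ContinuousMap.comp f ⟨fun y => s • y, continuous_const_smul s⟩).toComplex := by
  ext x
  rw [ContinuousMap.tr_apply]
  simp

theorem tr_add (s : G) (f g : C(X, ℂ)) : tr s (f + g) = tr s f + tr s g := rfl

theorem tr_smul (s : G) (c : ℂ) (f : C(X, ℂ)) : tr s (c • f) = c • tr s f := rfl

/-- The Riesz representation theorem passes between states and regular measures, and an ultrafilter
on `G` replaces membership in the closure of the orbit. Test functions split into real and imaginary
parts. -/
theorem isStronglyProximal_iff [T2Space X] : IsStronglyProximal G X ↔ IsStateProximal G X := by
  let _ : MeasurableSpace X := borel X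
  have : BorelSpace X := ⟨rfl⟩
  have hmap : ∀ (ν : ProbabilityMeasure X) (s : G) (f : C(X, ℝ)),
      ∫ x, f x ∂(ν.map (f := fun y => s • y)
        (continuous_const_smul s).measurable.aemeasurable : Measure X) =
      ∫ x, f (s • x) ∂(ν : Measure X) := by
    intro ν s f
    rw [ProbabilityMeasure.toMeasure_map]
    exact integral_map (continuous_const_smul s).measurable.aemeasurable
      f.continuous.aestronglyMeasurable
  constructor
  · intro h τ hτ
    obtain ⟨μ, hμ, hreg, hint⟩ := hτ.exists_measure
    obtain ⟨x, hx⟩ := h ⟨μ, hμ⟩ hreg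
    set m : G → ProbabilityMeasure X := fun s => ProbabilityMeasure.map ⟨μ, hμ⟩
      (f := fun y => s • y) (continuous_const_smul s).measurable.aemeasurable
    -- The point mass is in the closure of the orbit, so its neighbourhoods pull back to a proper
    -- filter on `G`, which an ultrafilter refines.
    have hne : (comap m (𝓝 (diracProba x))).NeBot := by
      refine comap_neBot_iff.2 fun t ht => ?_
      obtain ⟨_, h1, s, rfl⟩ := mem_closure_iff_nhds.1 hx t ht
      exact ⟨s, h1⟩
    refine ⟨x, Ultrafilter.of (comap m (𝓝 (diracProba x))), ?_⟩
    have ht : Tendsto m (Ultrafilter.of (comap m (𝓝 (diracProba x))) : Filter G)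
        (𝓝 (diracProba x)) := tendsto_comap.mono_left (Ultrafilter.of_le _)
    rw [ProbabilityMeasure.tendsto_iff_forall_integral_tendsto] at ht
    have hreal : ∀ f : C(X, ℝ), Tendsto (fun s => τ (tr s⁻¹ f.toComplex))
        (Ultrafilter.of (comap m (𝓝 (diracProba x))) : Filter G) (𝓝 (f.toComplex x)) := by
      intro f
      have h1 := ht (BoundedContinuousFunction.mkOfCompact f)
      have h2 : ∀ s, τ (tr s⁻¹ f.toComplex) = ((∫ y, f y ∂(m s : Measure X) : ℝ) : ℂ) := by
        intro s
        rw [tr_toComplex, hint]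
        exact congrArg _ (hmap ⟨μ, hμ⟩ s f).symm
      simp only [h2]
      refine (Complex.continuous_ofReal.tendsto _).comp ?_
      have h3 : ∫ y, f y ∂(diracProba x : Measure X) = f x :=
        integral_dirac' _ _ f.continuous.stronglyMeasurable
      rw [← h3]
      exact h1
    intro f
    rw [f.eq_toComplex_add]
    simp only [tr_add, tr_smul, map_add, map_smul]
    exact (hreal _).add ((hreal _).const_smul _)
  · intro h ν _
    have hi : ∀ f : C(X, ℂ), Integrable f (ν : Measure X) := fun f =>
      f.continuous.integrable_of_hasCompactSupport (HasCompactSupport.of_compactSpace _)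
    let τ : C(X, ℂ) →ₗ[ℂ] ℂ :=
      { toFun := fun f => ∫ x, f x ∂(ν : Measure X)
        map_add' := fun f g => integral_add (hi f) (hi g)
        map_smul' := fun c f => integral_smul c _ }
    have hre : ∀ f : C(X, ℝ), τ f.toComplex = ((∫ x, f x ∂(ν : Measure X) : ℝ) : ℂ) :=
      fun f => integral_ofReal
    have hτ : IsUnitalPositive τ := by
      refine ⟨by simp [τ], fun f hf => ?_⟩
      have : f = (ContinuousMap.comp ⟨Complex.re, Complex.continuous_re⟩ f).toComplex := by
        ext x
        exact Complex.ext rfl (Complex.nonneg_iff.1 (hf x)).2.symm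
      rw [this, hre]
      exact Complex.zero_le_real.2 (integral_nonneg fun x => (Complex.nonneg_iff.1 (hf x)).1)
    obtain ⟨x, F, hF⟩ := h τ hτ
    refine ⟨x, mem_closure_of_tendsto (b := (F : Filter G)) (f := fun s : G =>
        ν.map (f := fun y => s • y) (continuous_const_smul s).measurable.aemeasurable) ?_
      (Eventually.of_forall fun s => ⟨s, rfl⟩)⟩
    rw [ProbabilityMeasure.tendsto_iff_forall_integral_tendsto]
    intro f
    have h1 := (Complex.continuous_re.tendsto _).comp (hF f.toContinuousMap.toComplex)
    have h3 : ∫ y, f y ∂(diracProba x : Measure X) = f x :=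
      integral_dirac' _ _ f.continuous.stronglyMeasurable
    rw [h3]
    convert h1 using 2 with s
    · have := hmap ν s f.toContinuousMap
      rw [Function.comp_apply, tr_toComplex, hre]
      exact this
    · rfl

end Riesz

/-! ### States on `C(Z)` -/

section StatesOnContinuousFunctions

open Filter Topology

variable {Z : Type v} [TopologicalSpace Z] [CompactSpace Z] [T2Space Z]

theorem ContinuousMap.exists_eq_eval_of_map_mul {τ : C(Z, ℂ) →ₗ[ℂ] ℂ} (h1 : τ 1 = 1)
    (hmul : ∀ f g, τ (f * g) = τ f * τ g) : ∃ z, ∀ f, τ f = f z := by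
  let χ : C(Z, ℂ) →ₐ[ℂ] ℂ := AlgHom.ofLinearMap τ h1 hmul
  obtain ⟨z, hz⟩ := (WeakDual.CharacterSpace.continuousMapEval_bijective (X := Z) (𝕜 := ℂ)).2
    (WeakDual.CharacterSpace.equivAlgHom.symm χ)
  refine ⟨z, fun f => ?_⟩
  have := congrArg (fun c : WeakDual.characterSpace ℂ C(Z, ℂ) => c f) hz
  exact this.symm

/-- A state that is multiplicative on a separating set of functions is an evaluation. -/
theorem IsUnitalPositive.exists_eq_eval {τ : C(Z, ℂ) →ₗ[ℂ] ℂ} (hτ : IsUnitalPositive τ)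
    (D : Set C(Z, ℂ)) (hsep : ∀ x y : Z, (∀ d ∈ D, d x = d y) → x = y)
    (hD : ∀ d ∈ D, ∀ f, τ (f * d) = τ f * τ d) : ∃ z, ∀ f, τ f = f z := by
  -- The multiplicative domain of `τ`. It is closed and contains the separating set `D`, so it is
  -- everything by Stone-Weierstrass.
  let S : StarSubalgebra ℂ C(Z, ℂ) :=
    { carrier := {h | ∀ f, τ (f * h) = τ f * τ h}
      mul_mem' := fun {h k} hh hk f => by
        rw [← mul_assoc, hk, hh, hk, mul_assoc]
      one_mem' := fun f => by simp [hτ.map_one]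
      add_mem' := fun {h k} hh hk f => by
        rw [mul_add, map_add, hh, hk, map_add, mul_add]
      zero_mem' := fun f => by simp
      algebraMap_mem' := fun c f => by
        rw [Algebra.algebraMap_eq_smul_one, mul_smul_comm, map_smul, map_smul, mul_one, hτ.map_one]
        simp [mul_comm]
      star_mem' := fun {h} hh f => by
        have := congrArg star (hh (star f))
        rwa [← hτ.apply_star, star_mul', star_star, star_mul', ← hτ.apply_star, ← hτ.apply_star,
          star_star] at this }
  have hclosed : IsClosed (S : Set C(Z, ℂ)) := by
    have : (S : Set C(Z, ℂ)) = ⋂ f : C(Z, ℂ), {h | τ (f * h) = τ f * τ h} := by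
      ext h; simp [S]
    rw [this]
    refine isClosed_iInter fun f => isClosed_eq ?_ ?_
    · exact hτ.continuous.comp (continuous_const_mul f)
    · exact continuous_const.mul hτ.continuous
  have htop : S = ⊤ := by
    have h := ContinuousMap.starSubalgebra_topologicalClosure_eq_top_of_separatesPoints S (by
      intro x y hxy
      by_contra hcon
      push Not at hcon
      exact hxy (hsep x y fun d hd => hcon _ ⟨d, fun f => hD d hd f, rfl⟩))
    rwa [(StarSubalgebra.topologicalClosure_minimal le_rfl hclosed).antisymm
      S.le_topologicalClosure] at h
  exact ContinuousMap.exists_eq_eval_of_map_mul hτ.map_one fun f g => by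
    have : g ∈ S := htop ▸ trivial
    exact this f

/-- Multiplying a state by `1 + f` gives a state, if `1 + f ≥ 0` and `f` has mean zero. -/
theorem IsUnitalPositive.perturb {Z : Type v} [TopologicalSpace Z] {τ : C(Z, ℂ) →ₗ[ℂ] ℂ} (hτ : IsUnitalPositive τ) {f : C(Z, ℂ)}
    (hf : 0 ≤ 1 + f) (hτf : τ f = 0) :
    IsUnitalPositive (τ ∘ₗ LinearMap.mulLeft ℂ (1 + f)) :=
  ⟨by simp [hτ.map_one, hτf], fun a ha => hτ.map_nonneg _ (mul_nonneg hf ha)⟩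

end StatesOnContinuousFunctions

/-! ### The space of means -/

/-- The means on `ℓ^∞(G)`. -/
def Mean (G : Type u) : Type u := {m : EllInfty G →ₗ[ℂ] ℂ // IsUnitalPositive m}

namespace Mean

open Filter Topology

variable {G : Type u}

instance : FunLike (Mean G) (EllInfty G) ℂ where
  coe m := m.1
  coe_injective _ _ h := Subtype.ext (DFunLike.coe_injective h)

instance : TopologicalSpace (Mean G) := .induced (fun m f => m f) inferInstance

theorem isEmbedding_coe : IsEmbedding (fun (m : Mean G) f => m f) :=
  ⟨⟨rfl⟩, fun _ _ h => DFunLike.coe_injective h⟩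

theorem continuous_apply (f : EllInfty G) : Continuous fun m : Mean G => m f :=
  (_root_.continuous_apply f).comp isEmbedding_coe.continuous

instance : T2Space (Mean G) := isEmbedding_coe.t2Space

theorem tendsto_iff {ι : Type*} {l : Filter ι} {a : ι → Mean G} {m : Mean G} :
    Tendsto a l (𝓝 m) ↔ ∀ f, Tendsto (fun i => a i f) l (𝓝 (m f)) := by
  rw [isEmbedding_coe.tendsto_nhds_iff, tendsto_pi_nhds]
  rfl

instance : CompactSpace (Mean G) := by
  refine ⟨isCompact_iff_ultrafilter_le_nhds.2 fun F _ => ?_⟩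
  obtain ⟨σ, hσ, hlim⟩ := exists_state_tendsto F (fun m : Mean G => m.1) (fun m => m.2)
  exact ⟨⟨σ, hσ⟩, trivial, tendsto_iff.2 hlim⟩

/-- The means that are nonnegative on `P`. -/
def nonnegOn (P : Set (EllInfty G)) : Set (Mean G) := {m | ∀ g ∈ P, 0 ≤ m g}

theorem isClosed_nonnegOn (P : Set (EllInfty G)) : IsClosed (nonnegOn P) := by
  have : nonnegOn P = ⋂ g ∈ P, {m | 0 ≤ m g} := by
    ext m; simp only [nonnegOn, Set.mem_ofPred_eq, Set.mem_iInter]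
  rw [this]
  exact isClosed_biInter fun g _ => isClosed_Ici.preimage (continuous_apply g)

/-- Krein-Milman for the compact set of means, seen in a product of copies of `ℂ`. Extremality is
kept only for midpoints, since the perturbations used later are symmetric. -/
theorem exists_extreme {P : Set (EllInfty G)} (hP : (nonnegOn P).Nonempty) :
    ∃ x ∈ nonnegOn P, ∀ y ∈ nonnegOn P, ∀ z ∈ nonnegOn P,
      (∀ g, y g + z g = 2 * x g) → y = x := by
  obtain ⟨_, ⟨⟨x, hx, rfl⟩, hext⟩⟩ :=
    ((isClosed_nonnegOn P).isCompact.image isEmbedding_coe.continuous).extremePoints_nonempty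
      (hP.image _)
  refine ⟨x, hx, fun y hy z hz h => ?_⟩
  have := hext ⟨y, hy, rfl⟩ ⟨z, hz, rfl⟩ ⟨1 / 2, 1 / 2, by norm_num, by norm_num, by norm_num, by
    ext g
    have := h g
    simp only [Pi.add_apply, Pi.smul_apply, Complex.real_smul]
    push_cast
    linear_combination (1 / 2) * this⟩
  exact isEmbedding_coe.injective this

/-- Elements of `ℓ^∞(G)` as functions on a set of means. -/
def toFunctions (A : Set (Mean G)) : EllInfty G →ₗ[ℂ] C(A, ℂ) where
  toFun g := ⟨fun a => a.1 g, (continuous_apply g).comp continuous_subtype_val⟩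
  map_add' f g := by ext a; exact map_add a.1.1 f g
  map_smul' c g := by ext a; exact map_smul a.1.1 c g

@[simp] theorem toFunctions_apply (A : Set (Mean G)) (g : EllInfty G) (a : A) :
    toFunctions A g a = a.1 g := rfl

theorem isUnitalPositive_toFunctions (A : Set (Mean G)) : IsUnitalPositive (toFunctions A) :=
  ⟨by ext a; exact a.1.2.map_one, fun g hg a => a.1.2.map_nonneg g hg⟩

/-- The barycenter of a state on the functions on a set of means. -/
def barycenter {A : Set (Mean G)} {τ : C(A, ℂ) →ₗ[ℂ] ℂ} (hτ : IsUnitalPositive τ) : Mean G :=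
  ⟨τ ∘ₗ toFunctions A, hτ.comp (isUnitalPositive_toFunctions A)⟩

theorem barycenter_apply {A : Set (Mean G)} {τ : C(A, ℂ) →ₗ[ℂ] ℂ} (hτ : IsUnitalPositive τ)
    (g : EllInfty G) : barycenter hτ g = τ (toFunctions A g) := rfl

theorem barycenter_mem {P : Set (EllInfty G)} {A : Set (Mean G)} (hA : A ⊆ nonnegOn P)
    {τ : C(A, ℂ) →ₗ[ℂ] ℂ} (hτ : IsUnitalPositive τ) : barycenter hτ ∈ nonnegOn P :=
  fun g hg => hτ.map_nonneg _ fun a => hA a.2 g hg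

/-- A state whose barycenter is extreme is the evaluation at the barycenter. -/
theorem exists_eq_eval_of_barycenter_extreme {P : Set (EllInfty G)} {A : Set (Mean G)}
    (hAc : IsClosed A) (hA : A ⊆ nonnegOn P) {x : Mean G}
    (hx : ∀ y ∈ nonnegOn P, ∀ z ∈ nonnegOn P, (∀ g, y g + z g = 2 * x g) → y = x)
    {τ : C(A, ℂ) →ₗ[ℂ] ℂ} (hτ : IsUnitalPositive τ) (hb : barycenter hτ = x) :
    ∃ a : A, a.1 = x ∧ ∀ f, τ f = f a := by
  have : CompactSpace A := isCompact_iff_compactSpace.1 hAc.isCompact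
  have hreal : ∀ (f : C(A, ℝ)) (g : EllInfty G),
      τ (f.toComplex * toFunctions A g) = τ f.toComplex * τ (toFunctions A g) := by
    intro f g
    set c := τ f.toComplex with hc
    have him : c.im = 0 := hτ.im_apply_eq_zero f.isSelfAdjoint_toComplex
    have hcre : c = (c.re : ℂ) := Complex.ext rfl (by simp [him])
    -- Centre `f`, so that `τ` multiplied by `1 ± ε f₀` is again a state for small `ε`. The
    -- barycenters of these two states average to `x`.
    set f₀ : C(A, ℂ) := f.toComplex - c • 1 with hf₀
    have hτf₀ : τ f₀ = 0 := by rw [hf₀, map_sub, map_smul, hτ.map_one]; simp [c]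
    obtain ⟨ε, hε, hpos⟩ : ∃ ε : ℝ, 0 < ε ∧ ∀ δ : ℝ, |δ| ≤ ε → 0 ≤ 1 + (δ : ℂ) • f₀ := by
      refine ⟨(‖f‖ + |c.re| + 1)⁻¹, by positivity, fun δ hδ a => ?_⟩
      have h1 : |f a - c.re| ≤ ‖f‖ + |c.re| + 1 := by
        have := f.norm_coe_le_norm a
        rw [Real.norm_eq_abs] at this
        linarith [abs_sub (f a) c.re]
      have h2 : |δ * (f a - c.re)| ≤ 1 := by
        rw [abs_mul]
        calc |δ| * |f a - c.re| ≤ (‖f‖ + |c.re| + 1)⁻¹ * (‖f‖ + |c.re| + 1) := by gcongr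
          _ = 1 := inv_mul_cancel₀ (by positivity)
      have h3 : (1 + (δ : ℂ) • f₀) a = ((1 + δ * (f a - c.re) : ℝ) : ℂ) := by
        rw [hf₀, hcre]; simp
      change 0 ≤ (1 + (δ : ℂ) • f₀) a
      rw [h3]
      exact Complex.zero_le_real.2 (by linarith [(abs_le.1 h2).1])
    have hs : ∀ δ : ℝ, |δ| ≤ ε →
        IsUnitalPositive (τ ∘ₗ LinearMap.mulLeft ℂ (1 + (δ : ℂ) • f₀)) := fun δ hδ =>
      hτ.perturb (hpos δ hδ) (by rw [map_smul, hτf₀, smul_zero])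
    have h1 := hs ε (abs_of_pos hε).le
    have h2 := hs (-ε) (by rw [abs_neg, abs_of_pos hε])
    have e := hx _ (barycenter_mem hA h1) _ (barycenter_mem hA h2) (by
      intro g
      rw [← hb, barycenter_apply, barycenter_apply, barycenter_apply]
      simp only [LinearMap.comp_apply, LinearMap.mulLeft_apply, add_mul, one_mul, map_add,
        smul_mul_assoc, map_smul]
      simp
      ring)
    -- Extremality makes the perturbed barycenter equal to `x`, hence `ε τ(f₀ g) = 0`, which is the
    -- desired multiplicativity.
    have e2 := DFunLike.congr_fun e g
    rw [← hb, barycenter_apply, barycenter_apply] at e2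
    simp only [LinearMap.comp_apply, LinearMap.mulLeft_apply, add_mul, one_mul, map_add,
      smul_mul_assoc, map_smul, add_eq_left, smul_eq_zero] at e2
    rcases e2 with e2 | e2
    · exact absurd (Complex.ofReal_eq_zero.1 e2) hε.ne'
    · rw [hf₀, sub_mul, map_sub, sub_eq_zero, smul_mul_assoc, one_mul, map_smul] at e2
      exact e2
  -- Elements of `ℓ^∞(G)` separate means, so multiplicativity against them suffices.
  obtain ⟨a, ha⟩ := hτ.exists_eq_eval (Set.range (toFunctions A))
    (fun a b h => Subtype.ext (DFunLike.ext _ _ fun g => h _ ⟨g, rfl⟩)) (by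
      rintro _ ⟨g, rfl⟩ f
      rw [f.eq_toComplex_add, add_mul, map_add, smul_mul_assoc, map_smul, hreal, hreal, map_add,
        map_smul, add_mul, smul_mul_assoc])
  refine ⟨a, ?_, ha⟩
  rw [← hb]
  refine DFunLike.ext _ _ fun g => ?_
  rw [barycenter_apply, ha, toFunctions_apply]

/-- If `x` is nonnegative on all elements that are nonnegative on `A`, it is the barycenter of a
state. -/
theorem exists_barycenter_eq {A : Set (Mean G)} (hAc : IsClosed A) {x : Mean G}
    (hx : x ∈ nonnegOn {g | ∀ a ∈ A, 0 ≤ a g}) :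
    ∃ (τ : C(A, ℂ) →ₗ[ℂ] ℂ) (hτ : IsUnitalPositive τ), barycenter hτ = x := by
  have : CompactSpace A := isCompact_iff_compactSpace.1 hAc.isCompact
  set β := toFunctions A
  have : Module.Projective ℂ (LinearMap.range β) :=
    have := Module.Free.of_divisionRing ℂ (LinearMap.range β)
    Module.Projective.of_free
  -- The functional `σ` with `σ(β g) = x g` is written through a linear section `r` of `β`. The
  -- choice of section is immaterial because `x` vanishes on the kernel of `β`, by positivity on `g`
  -- and `-g`.
  obtain ⟨r, hr⟩ := β.rangeRestrict.exists_rightInverse_of_surjective β.range_rangeRestrict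
  have hr' : ∀ w : LinearMap.range β, β (r w) = w := fun w =>
    congrArg Subtype.val (LinearMap.congr_fun hr w)
  let σ : LinearMap.range β →ₗ[ℂ] ℂ := x.1 ∘ₗ r
  have hpos : ∀ g, 0 ≤ β g → 0 ≤ x g := fun g hg => hx g fun a ha => hg ⟨a, ha⟩
  have hzero : ∀ g, β g = 0 → x g = 0 := by
    intro g hg
    have h1 := hpos g (by rw [hg])
    have h2 := hpos (-g) (by rw [map_neg, hg, neg_zero])
    have h3 : x (-g) = -x g := map_neg x.1 g
    rw [h3] at h2
    exact le_antisymm (neg_nonneg.1 h2) h1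
  have hσ : ∀ g, σ ⟨β g, g, rfl⟩ = x g := by
    intro g
    have : x.1 (r ⟨β g, g, rfl⟩ - g) = 0 := hzero _ (by rw [map_sub, hr', sub_self])
    rw [map_sub, sub_eq_zero] at this
    exact this
  have h1 : (1 : C(A, ℂ)) ∈ LinearMap.range β := ⟨1, (isUnitalPositive_toFunctions A).map_one⟩
  have hstar : ∀ f ∈ LinearMap.range β, star f ∈ LinearMap.range β := by
    rintro _ ⟨g, rfl⟩
    refine ⟨star g, ?_⟩
    ext a
    exact a.1.2.apply_star g
  have hσ1 : σ ⟨1, h1⟩ = 1 := by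
    have e : (⟨1, h1⟩ : LinearMap.range β) = ⟨β 1, 1, rfl⟩ :=
      Subtype.ext (isUnitalPositive_toFunctions A).map_one.symm
    rw [e, hσ]
    exact x.2.map_one
  have hσpos : ∀ w : LinearMap.range β, 0 ≤ (w : C(A, ℂ)) → 0 ≤ σ w := by
    rintro ⟨_, g, rfl⟩ hw
    rw [hσ]
    exact hpos g hw
  obtain ⟨τ, hτ, hext⟩ := exists_state_extension h1 σ hσ1
    (OperatorSystem.norm_apply_le h1 hstar σ hσ1 hσpos)
  refine ⟨τ, hτ, DFunLike.ext _ _ fun g => ?_⟩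
  rw [barycenter_apply, ← hσ g]
  exact hext ⟨β g, g, rfl⟩

end Mean

/-! ### A universal boundary inside the space of means -/

namespace EllInfty

variable {G : Type u} [Group G]

/-- Translation, as a linear map. -/
def translateₗ (s : G) : EllInfty G →ₗ[ℂ] EllInfty G where
  toFun := translate s
  map_add' _ _ := rfl
  map_smul' _ _ := rfl

theorem isUnitalPositive_translateₗ (s : G) : IsUnitalPositive (translateₗ s) :=
  ⟨rfl, fun _ hf t => hf (s⁻¹ * t)⟩

theorem translate_one (f : EllInfty G) : translate 1 f = f := by
  refine ext fun t => ?_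
  rw [translate_apply, inv_one, one_mul]

theorem translate_mul (s t : G) (f : EllInfty G) :
    translate (s * t) f = translate s (translate t f) := by
  refine ext fun r => ?_
  simp only [translate_apply]
  rw [mul_inv_rev, mul_assoc]

end EllInfty

namespace Mean

open Filter Topology

variable {G : Type u} [Group G]

instance : MulAction G (Mean G) where
  smul s m := ⟨m.1 ∘ₗ EllInfty.translateₗ s⁻¹, m.2.comp (EllInfty.isUnitalPositive_translateₗ _)⟩
  one_smul m := DFunLike.ext _ _ fun f => by
    change m (EllInfty.translate 1⁻¹ f) = m f
    rw [inv_one, EllInfty.translate_one]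
  mul_smul s t m := DFunLike.ext _ _ fun f => by
    change m (EllInfty.translate (s * t)⁻¹ f) = m (EllInfty.translate t⁻¹ (EllInfty.translate s⁻¹ f))
    rw [mul_inv_rev, EllInfty.translate_mul]

theorem smul_apply (s : G) (m : Mean G) (f : EllInfty G) :
    (s • m) f = m (EllInfty.translate s⁻¹ f) := rfl

instance : ContinuousConstSMul G (Mean G) where
  continuous_const_smul s := by
    rw [isEmbedding_coe.continuous_iff]
    exact continuous_pi fun f => continuous_apply (EllInfty.translate s⁻¹ f)

/-- There is a largest invariant set of elements of `ℓ^∞(G)` on which some mean is nonnegative. -/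
theorem exists_maximal_nonnegOn (G : Type u) [Group G] : ∃ P : Set (EllInfty G),
    (∀ (s : G), ∀ g ∈ P, EllInfty.translate s g ∈ P) ∧ (nonnegOn P).Nonempty ∧
    ∀ Q : Set (EllInfty G), (∀ (s : G), ∀ g ∈ Q, EllInfty.translate s g ∈ Q) →
      (nonnegOn Q).Nonempty → P ⊆ Q → Q = P := by
  -- Enlarging `P` shrinks `nonnegOn P`, so a maximal `P` encodes a minimal closed convex invariant
  -- set of means. Compactness provides a common mean for the union of a chain; for the empty chain
  -- any mean will do.
  obtain ⟨P, hP⟩ := zorn_subset {P : Set (EllInfty G) |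
      (∀ (s : G), ∀ g ∈ P, EllInfty.translate s g ∈ P) ∧ (nonnegOn P).Nonempty} (by
    intro c hc hchain
    refine ⟨⋃₀ c, ⟨?_, ?_⟩, fun P hP => Set.subset_sUnion_of_mem hP⟩
    · rintro s g ⟨P, hP, hg⟩
      exact ⟨P, hP, (hc hP).1 s g hg⟩
    · rcases c.eq_empty_or_nonempty with rfl | hne
      · exact ⟨⟨EllInfty.eval 1, EllInfty.isUnitalPositive_eval 1⟩, fun g hg => by simp at hg⟩
      · have : Nonempty c := hne.to_subtype
        obtain ⟨m, hm⟩ := IsCompact.nonempty_iInter_of_directed_nonempty_isCompact_isClosed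
          (fun P : c => nonnegOn P.1) (by
            intro P Q
            rcases hchain.total P.2 Q.2 with h | h
            · exact ⟨Q, fun m hm g hg => hm g (h hg), subset_rfl⟩
            · exact ⟨P, subset_rfl, fun m hm g hg => hm g (h hg)⟩)
          (fun P => (hc P.2).2) (fun P => (isClosed_nonnegOn _).isCompact)
          (fun P => isClosed_nonnegOn _)
        refine ⟨m, ?_⟩
        rintro g ⟨P, hP, hg⟩
        exact Set.mem_iInter.1 hm ⟨P, hP⟩ g hg)
  exact ⟨P, hP.prop.1, hP.prop.2, fun Q h1 h2 h3 => (hP.eq_of_subset ⟨h1, h2⟩ h3).symm⟩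

/-- The orbit closure of a mean, as an invariant set. -/
def orbitClosure (x : Mean G) : SubMulAction G (Mean G) where
  carrier := closure (MulAction.orbit G x)
  smul_mem' s y hy := by
    have h := image_closure_subset_closure_image (continuous_const_smul s)
      (s := MulAction.orbit G x) ⟨y, hy, rfl⟩
    refine closure_mono ?_ h
    rintro _ ⟨z, hz, rfl⟩
    exact MulAction.mem_orbit_of_mem_orbit s hz

end Mean

open Filter Topology Mean in
/-- There is a boundary that maps into the means. -/
theorem exists_universal_boundary (G : Type u) [Group G] :
    ∃ (X : Type u) (_ : TopologicalSpace X) (_ : CompactSpace X) (_ : T2Space X)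
      (_ : MulAction G X) (_ : ContinuousConstSMul G X), Nonempty X ∧ MulAction.IsMinimal G X ∧
      IsStateProximal G X ∧ ∃ β : EllInfty G →ₗ[ℂ] C(X, ℂ), IsGMap G β := by
  obtain ⟨P, hinv, hne, hmax⟩ := exists_maximal_nonnegOn G
  obtain ⟨x, hxP, hext⟩ := exists_extreme hne
  have hPinv : ∀ (s : G), ∀ m ∈ nonnegOn P, s • m ∈ nonnegOn P := fun s m hm g hg => by
    rw [Mean.smul_apply]
    exact hm _ (hinv s⁻¹ g hg)
  have hclos : ∀ y ∈ nonnegOn P, (orbitClosure y : Set (Mean G)) ⊆ nonnegOn P := by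
    intro y hy
    refine closure_minimal ?_ (isClosed_nonnegOn P)
    rintro _ ⟨s, rfl⟩
    exact hPinv s y hy
  have hmem : ∀ y ∈ nonnegOn P, x ∈ closure (MulAction.orbit G y) := by
    intro y hy
    -- The elements nonnegative on the orbit closure of `y` form an invariant set containing `P`, so
    -- by maximality there are no new ones: the closed convex hull of the orbit is all of `nonnegOn
    -- P`.
    have hQ : {g | ∀ a ∈ closure (MulAction.orbit G y), 0 ≤ a g} = P := by
      refine hmax _ ?_ ⟨y, fun g hg => hg y (subset_closure (MulAction.mem_orbit_self y))⟩
        fun g hg a ha => hclos y hy ha g hg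
      intro s g hg a ha
      have h := hg (s⁻¹ • a) ((orbitClosure y).smul_mem s⁻¹ ha)
      rwa [Mean.smul_apply, inv_inv] at h
    obtain ⟨τ, hτ, hb⟩ := exists_barycenter_eq (A := closure (MulAction.orbit G y))
      isClosed_closure (x := x) (by rw [hQ]; exact hxP)
    -- Milman's converse to Krein-Milman: the extreme point `x` already belongs to the closed set
    -- whose hull contains it.
    obtain ⟨a, rfl, -⟩ := exists_eq_eval_of_barycenter_extreme isClosed_closure (hclos y hy) hext
      hτ hb
    exact a.2
  let X := orbitClosure (G := G) x
  have hcomp : CompactSpace X := isCompact_iff_compactSpace.1 isClosed_closure.isCompact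
  have hcont : ContinuousConstSMul G X := ⟨fun s =>
    ((continuous_const_smul s).comp continuous_subtype_val).subtype_mk _⟩
  have hXP : (X : Set (Mean G)) ⊆ nonnegOn P := hclos x hxP
  let β : EllInfty G →ₗ[ℂ] C(X, ℂ) := toFunctions (X : Set (Mean G))
  have hβ : IsGMap G β := by
    refine ⟨isUnitalPositive_toFunctions _, fun s g => ?_⟩
    ext a
    change a.1 (EllInfty.translate s g) = (s⁻¹ • a.1) g
    rw [Mean.smul_apply, inv_inv]
  refine ⟨X, inferInstance, hcomp, inferInstance, inferInstance, hcont,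
    ⟨⟨x, subset_closure (MulAction.mem_orbit_self x)⟩⟩, ⟨fun y => ?_⟩, ?_, β, hβ⟩
  · intro z
    have h1 : (X : Set (Mean G)) ⊆ closure (MulAction.orbit G y.1) := by
      refine closure_minimal ?_ isClosed_closure
      rintro _ ⟨s, rfl⟩
      exact (orbitClosure y.1).smul_mem s (hmem y.1 (hXP y.2))
    have h2 := h1 z.2
    rw [closure_subtype]
    convert h2
    ext w
    constructor
    · rintro ⟨_, ⟨s, rfl⟩, rfl⟩
      exact ⟨s, rfl⟩
    · rintro ⟨s, rfl⟩
      exact ⟨s • y, ⟨s, rfl⟩, rfl⟩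
  · intro τ hτ
    -- Proximality: some translates of the barycenter `m` of `τ` converge to `x`. A limit of the
    -- corresponding translates of `τ` has barycenter `x`, so it is an evaluation.
    have hm : barycenter (A := (X : Set (Mean G))) hτ ∈ nonnegOn P := barycenter_mem hXP hτ
    set m := barycenter (A := (X : Set (Mean G))) hτ
    have hne : (comap (fun s : G => s • m) (𝓝 x)).NeBot := by
      refine comap_neBot_iff.2 fun t ht => ?_
      obtain ⟨_, h1, s, rfl⟩ := mem_closure_iff_nhds.1 (hmem m hm) t ht
      exact ⟨s, h1⟩
    set F := Ultrafilter.of (comap (fun s : G => s • m) (𝓝 x))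
    have hF : Tendsto (fun s : G => s • m) F (𝓝 x) :=
      tendsto_comap.mono_left (Ultrafilter.of_le _)
    let trₗ : G → C(X, ℂ) →ₗ[ℂ] C(X, ℂ) := fun s =>
      (GOperatorSystem.translate X s).toLinearMap
    obtain ⟨σ, hσ, hlim⟩ := exists_state_tendsto F (fun s => τ ∘ₗ trₗ s⁻¹) (fun s =>
      hτ.comp ⟨rfl, fun f (hf : ∀ y, 0 ≤ f y) y => hf _⟩)
    have hb : barycenter (A := (X : Set (Mean G))) hσ = x := by
      refine DFunLike.ext _ _ fun g => ?_
      refine tendsto_nhds_unique (hlim (β g)) ?_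
      have := tendsto_iff.1 hF g
      refine this.congr fun s => ?_
      change τ (β (tr s⁻¹ g)) = τ (tr s⁻¹ (β g))
      rw [hβ.equivariant]
    obtain ⟨a, -, ha⟩ := exists_eq_eval_of_barycenter_extreme (A := (X : Set (Mean G)))
      isClosed_closure hXP hext hσ hb
    refine ⟨a, F, fun f => ?_⟩
    rw [← ha f]
    exact hlim f

/-! ### Rigidity of boundaries -/

section Rigidity

open Filter Topology

variable {G : Type u} [Group G]
variable {X : Type v} [TopologicalSpace X] [CompactSpace X] [MulAction G X]
  [ContinuousConstSMul G X]
variable {B : Type w} [TopologicalSpace B] [CompactSpace B] [MulAction G B]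
  [ContinuousConstSMul G B]

/-- Equivariant unital positive maps out of a proximal space into a minimal space are
multiplicative. -/
theorem IsStateProximal.map_mul (hB : IsStateProximal G B) (hX : MulAction.IsMinimal G X)
    {θ : C(B, ℂ) →ₗ[ℂ] C(X, ℂ)} (hθ : IsGMap G θ) (f g : C(B, ℂ)) :
    θ (f * g) = θ f * θ g := by
  ext x₀
  obtain ⟨b, F, hF⟩ := hB _ ((ContinuousMap.isUnitalPositive_evalₗ x₀).comp hθ.toIsUnitalPositive)
  -- Along the ultrafilter that moves the state `f ↦ θ f x₀` to the evaluation at `b`, the points `s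
  -- • x₀` converge to some `x₁`. So `θ` followed by evaluation at `x₁` is evaluation at `b`.
  obtain ⟨x₁, -, hx₁⟩ := isCompact_univ.ultrafilter_le_nhds (F.map fun s : G => s • x₀) (by simp)
  have hx₁' : Tendsto (fun s : G => s • x₀) F (𝓝 x₁) := hx₁
  have hev : ∀ f, θ f x₁ = f b := by
    intro f
    refine tendsto_nhds_unique (((θ f).continuous.tendsto x₁).comp hx₁') ((hF f).congr fun s => ?_)
    simp only [LinearMap.comp_apply, ContinuousMap.evalₗ_apply, hθ.equivariant,
      ContinuousMap.tr_apply, inv_inv, Function.comp_apply]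
  -- The set of points where `θ` is multiplicative is closed and contains the orbit of `x₁`, which
  -- is dense by minimality.
  let Z : Set X := {x | ∀ f g, θ (f * g) x = θ f x * θ g x}
  have hZc : IsClosed Z := by
    have : Z = ⋂ (f : C(B, ℂ)) (g : C(B, ℂ)), {x | θ (f * g) x = θ f x * θ g x} := by
      ext; simp [Z]
    rw [this]
    exact isClosed_iInter fun f => isClosed_iInter fun g =>
      isClosed_eq (θ (f * g)).continuous ((θ f).continuous.mul (θ g).continuous)
  have horb : MulAction.orbit G x₁ ⊆ Z := by
    rintro _ ⟨s, rfl⟩ f g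
    have h : ∀ f, θ f (s • x₁) = f (s • b) := by
      intro f
      have h1 := hev (tr s⁻¹ f)
      rw [hθ.equivariant, ContinuousMap.tr_apply, ContinuousMap.tr_apply, inv_inv] at h1
      exact h1
    simp [h]
  have hx₀ : x₀ ∈ Z := hZc.closure_subset_iff.2 horb (hX.dense_orbit x₁ x₀)
  exact hx₀ f g

variable (G X) in
/-- Every unital positive equivariant map on `C(X)` is the identity. -/
def IsGRigid : Prop :=
  ∀ θ : C(X, ℂ) →ₗ[ℂ] C(X, ℂ), IsGMap G θ → θ = LinearMap.id

/-- Both `θ` and `(θ + id) / 2` are multiplicative. Comparing their values on `f²` gives `(θ f - f)²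
= 0` pointwise. -/
theorem IsStateProximal.isGRigid (hB : IsStateProximal G B) (hm : MulAction.IsMinimal G B) :
    IsGRigid G B := by
  intro θ hθ
  have h1 := hB.map_mul hm hθ
  have h2 := hB.map_mul hm (θ := (1 / 2 : ℂ) • (θ + LinearMap.id))
    { map_one := by
        ext x
        simp [hθ.map_one]
        norm_num
      map_nonneg := fun f hf x => by
        have e1 : 0 ≤ θ f x := hθ.map_nonneg f hf x
        have e2 : 0 ≤ f x := hf x
        have e3 : (0 : ℂ) ≤ 1 / 2 := by
          have : ((1 / 2 : ℝ) : ℂ) = 1 / 2 := by push_cast; rfl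
          rw [← this]
          exact Complex.zero_le_real.2 (by norm_num)
        exact mul_nonneg e3 (add_nonneg e1 e2)
      equivariant := fun s f => by
        simp only [LinearMap.smul_apply, LinearMap.add_apply, LinearMap.id_apply, hθ.equivariant]
        rfl }
  ext f x
  have e1 := congrArg (fun k : C(B, ℂ) => k x) (h1 f f)
  have e2 := congrArg (fun k : C(B, ℂ) => k x) (h2 f f)
  simp only [LinearMap.smul_apply, LinearMap.add_apply, LinearMap.id_apply,
    ContinuousMap.mul_apply, ContinuousMap.smul_apply, ContinuousMap.add_apply, smul_eq_mul]
    at e1 e2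
  rw [e1] at e2
  have : (θ f x - f x) ^ 2 = 0 := by linear_combination 4 * e2
  rw [LinearMap.id_apply]
  exact sub_eq_zero.1 (pow_eq_zero_iff two_ne_zero |>.1 this)

/-- Equivariant unital positive maps out of a boundary into a minimal space are induced by maps of
spaces. -/
theorem IsStateProximal.exists_map [T2Space B] (hB : IsStateProximal G B)
    (hBm : MulAction.IsMinimal G B) (hX : MulAction.IsMinimal G X) [Nonempty X]
    {θ : C(B, ℂ) →ₗ[ℂ] C(X, ℂ)} (hθ : IsGMap G θ) :
    ∃ h : X → B, Continuous h ∧ Function.Surjective h ∧ (∀ (s : G) (x : X), h (s • x) = s • h x) ∧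
      ∀ f x, θ f x = f (h x) := by
  have hmul := hB.map_mul hX hθ
  have hex : ∀ x, ∃ b, ∀ f, θ f x = f b := fun x =>
    ContinuousMap.exists_eq_eval_of_map_mul (τ := ContinuousMap.evalₗ x ∘ₗ θ)
      (by simp [hθ.map_one]) (fun f g => by simp [hmul])
  choose h hh using hex
  have hcont : Continuous h := by
    have hemb : IsClosedEmbedding (fun (b : B) (f : C(B, ℂ)) => f b) :=
      Continuous.isClosedEmbedding (continuous_pi fun f => f.continuous)
        fun b c hbc => ContinuousMap.eq_of_forall_apply_eq fun f => congrFun hbc f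
    rw [hemb.isInducing.continuous_iff]
    refine continuous_pi fun f => ?_
    exact (θ f).continuous.congr (fun x => hh x f)
  have hequiv : ∀ (s : G) (x : X), h (s • x) = s • h x := by
    intro s x
    refine ContinuousMap.eq_of_forall_apply_eq fun f => ?_
    have h1 := hh x (tr s⁻¹ f)
    rw [hθ.equivariant, ContinuousMap.tr_apply, ContinuousMap.tr_apply, inv_inv] at h1
    rw [← h1, hh]
  refine ⟨h, hcont, ?_, hequiv, fun f x => hh x f⟩
  -- The image of `h` is compact and contains a whole orbit of `B`, which is dense.
  rw [← Set.range_eq_univ, ← (isCompact_range hcont).isClosed.closure_eq]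
  obtain ⟨x⟩ := ‹Nonempty X›
  refine Set.eq_univ_of_univ_subset fun b _ => ?_
  refine closure_mono ?_ (hBm.dense_orbit (h x) b)
  rintro _ ⟨s, rfl⟩
  exact ⟨s • x, hequiv s x⟩

end Rigidity

/-! ### Rigid retracts of `ℓ^∞(G)` -/

section RigidRetract

open Filter Topology

variable (G : Type u) [Group G]

/-- `C(X)` is rigid and is an equivariant retract of `ℓ^∞(G)`. -/
structure IsRigidRetract (X : Type v) [TopologicalSpace X] [CompactSpace X] [MulAction G X]
    [ContinuousConstSMul G X] : Prop where
  rigid : IsGRigid G X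
  exists_to : ∃ α : C(X, ℂ) →ₗ[ℂ] EllInfty G, IsGMap G α
  exists_from : ∃ β : EllInfty G →ₗ[ℂ] C(X, ℂ), IsGMap G β

variable {G}
variable {X : Type v} [TopologicalSpace X] [CompactSpace X] [MulAction G X]
  [ContinuousConstSMul G X]
variable {Y : Type w} [TopologicalSpace Y] [CompactSpace Y] [MulAction G Y]
  [ContinuousConstSMul G Y]

theorem IsStateProximal.isRigidRetract (hX : IsStateProximal G X) (hm : MulAction.IsMinimal G X)
    (x : X) {β : EllInfty G →ₗ[ℂ] C(X, ℂ)} (hβ : IsGMap G β) : IsRigidRetract G X :=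
  ⟨hX.isGRigid hm, ⟨_, isGMap_orbitHom x⟩, ⟨β, hβ⟩⟩

/-! ### Dynamics of rigid retracts and comparison of boundaries -/

namespace IsRigidRetract

theorem nonempty (hX : IsRigidRetract G X) : Nonempty X := by
  by_contra h
  rw [not_nonempty_iff] at h
  obtain ⟨α, hα⟩ := hX.exists_to
  have h1 : (1 : C(X, ℂ)) = 0 := Subsingleton.elim _ _
  have h2 := hα.map_one
  rw [h1, map_zero] at h2
  have h3 := congrArg (fun f : EllInfty G => f 1) h2
  exact zero_ne_one h3

theorem comp_eq_id (hX : IsGRigid G X) {α : C(X, ℂ) →ₗ[ℂ] EllInfty G} (hα : IsGMap G α)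
    {β : EllInfty G →ₗ[ℂ] C(X, ℂ)} (hβ : IsGMap G β) (f : C(X, ℂ)) : β (α f) = f :=
  LinearMap.congr_fun (hX _ (hβ.comp hα)) f

theorem _root_.IsStateProximal.of_homeomorph (hB : IsStateProximal G Y) (h : X ≃ₜ Y)
    (hh : ∀ (s : G) (x : X), h (s • x) = s • h x) : IsStateProximal G X := by
  intro τ hτ
  let c : C(Y, ℂ) →ₗ[ℂ] C(X, ℂ) :=
    { toFun := fun f => f.comp ⟨h, h.continuous⟩
      map_add' := fun _ _ => rfl
      map_smul' := fun _ _ => rfl }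
  have hc : IsUnitalPositive c := ⟨rfl, fun f (hf : ∀ y, 0 ≤ f y) x => hf (h x)⟩
  obtain ⟨y, F, hF⟩ := hB _ (hτ.comp hc)
  refine ⟨h.symm y, F, fun f => ?_⟩
  refine (hF (f.comp ⟨h.symm, h.symm.continuous⟩)).congr fun s => ?_
  rw [LinearMap.comp_apply]
  congr 1
  ext x
  change f (h.symm (s⁻¹⁻¹ • h x)) = f (s⁻¹⁻¹ • x)
  rw [← hh, h.symm_apply_apply]

/-- Rigid retracts can be transported along equivariant order isomorphisms. -/
theorem of_equiv (hX : IsRigidRetract G X) {φ : C(Y, ℂ) →ₗ[ℂ] C(X, ℂ)} (hφ : IsGMap G φ)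
    {ψ : C(X, ℂ) →ₗ[ℂ] C(Y, ℂ)} (hψ : IsGMap G ψ) (h : ψ ∘ₗ φ = LinearMap.id) :
    IsRigidRetract G Y := by
  obtain ⟨β, hβ⟩ := hX.exists_from
  obtain ⟨α, hα⟩ := hX.exists_to
  refine ⟨fun θ hθ => ?_, ⟨_, hα.comp hφ⟩, ⟨_, hψ.comp hβ⟩⟩
  -- An endomorphism of `C(Y)` is conjugated to one of `C(X)`, where rigidity applies.
  have h1 := hX.rigid _ (hφ.comp (hθ.comp hψ))
  calc θ = (ψ ∘ₗ φ) ∘ₗ θ ∘ₗ (ψ ∘ₗ φ) := by rw [h]; rfl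
    _ = ψ ∘ₗ (φ ∘ₗ θ ∘ₗ ψ) ∘ₗ φ := rfl
    _ = LinearMap.id := by rw [h1]; exact h

variable [T2Space X] [T2Space Y]

/-- If the orbit of `x` were not dense, a nonzero function would vanish on it. Restriction to the
orbit kills that function, yet followed by `β` it is the identity. -/
theorem isMinimal (hX : IsRigidRetract G X) : MulAction.IsMinimal G X := by
  obtain ⟨β, hβ⟩ := hX.exists_from
  refine ⟨fun x y => ?_⟩
  by_contra hy
  obtain ⟨f, hf0, hf1, -⟩ := exists_continuous_zero_one_of_isClosed
    (isClosed_closure (s := MulAction.orbit G x)) (isClosed_singleton (x := y)) (by simpa using hy)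
  have h1 : orbitHom (G := G) x f.toComplex = 0 := EllInfty.ext fun t => by
    rw [orbitHom_apply, ContinuousMap.toComplex_apply, hf0 (subset_closure ⟨t, rfl⟩)]
    simp
  have h2 := comp_eq_id hX.rigid (isGMap_orbitHom x) hβ f.toComplex
  have h3 : (orbitHom (G := G) x).toLinearMap f.toComplex = 0 := h1
  rw [h3, map_zero] at h2
  have h4 := congrArg (fun k : C(X, ℂ) => k y) h2
  simp [hf1 rfl] at h4

theorem exists_image (hX : IsRigidRetract G X) (hB : IsStateProximal G Y)
    (hBm : MulAction.IsMinimal G Y) [hne : Nonempty Y] : IsGImage G X Y := by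
  obtain ⟨β, hβ⟩ := hX.exists_from
  obtain ⟨b⟩ := hne
  have := hX.nonempty
  obtain ⟨h, h1, h2, h3, -⟩ := hB.exists_map hBm hX.isMinimal (hβ.comp (isGMap_orbitHom b))
  exact ⟨h, h1, h2, h3⟩

/-- The map `β ∘ α' : C(Y) → C(X)` comes from a surjection `h : X → Y`. By rigidity of `X` it has a
right inverse, so functions of the form `f ∘ h` exhaust `C(X)` and `h` is injective. -/
theorem exists_homeomorph_of_isStateProximal (hX : IsRigidRetract G X) (hY : IsRigidRetract G Y)
    (hB : IsStateProximal G Y) : ∃ h : X ≃ₜ Y, ∀ (s : G) (x : X), h (s • x) = s • h x := by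
  obtain ⟨β, hβ⟩ := hX.exists_from
  obtain ⟨α, hα⟩ := hX.exists_to
  obtain ⟨β', hβ'⟩ := hY.exists_from
  obtain ⟨α', hα'⟩ := hY.exists_to
  have := hX.nonempty
  obtain ⟨h, h1, h2, h3, h4⟩ := hB.exists_map hY.isMinimal hX.isMinimal (hβ.comp hα')
  have hid := hX.rigid _ ((hβ.comp hα').comp (hβ'.comp hα))
  have hinj : Function.Injective h := by
    intro x y hxy
    refine ContinuousMap.eq_of_forall_apply_eq fun f => ?_
    have e := LinearMap.congr_fun hid f
    rw [LinearMap.comp_apply, LinearMap.id_apply] at e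
    rw [← e, h4, h4, hxy]
  exact ⟨Continuous.homeoOfEquivCompactToT2 (f := Equiv.ofBijective h ⟨hinj, h2⟩) h1, h3⟩

/-- Proximality is not derived directly: it is transported from the boundary in the space of means,
to which `X` is homeomorphic. -/
theorem isStateProximal (hX : IsRigidRetract G X) : IsStateProximal G X := by
  obtain ⟨X₀, _, _, _, _, _, ⟨x⟩, hm, hp, β, hβ⟩ := exists_universal_boundary G
  obtain ⟨h, hh⟩ := hX.exists_homeomorph_of_isStateProximal (hp.isRigidRetract hm x hβ) hp
  exact hp.of_homeomorph h hh

theorem exists_homeomorph (hX : IsRigidRetract G X) (hY : IsRigidRetract G Y) :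
    ∃ h : X ≃ₜ Y, ∀ (s : G) (x : X), h (s • x) = s • h x :=
  hX.exists_homeomorph_of_isStateProximal hY hY.isStateProximal

theorem isGBoundary (hX : IsRigidRetract G X) : IsGBoundary G X :=
  ⟨hX.nonempty, inferInstance, inferInstance, hX.isMinimal,
    isStronglyProximal_iff.2 hX.isStateProximal⟩

/-- A boundary that maps onto every boundary is a rigid retract. -/
theorem _root_.IsFurstenbergBoundary.isRigidRetract {X : Type u} [TopologicalSpace X]
    [CompactSpace X] [T2Space X] [MulAction G X] [ContinuousConstSMul G X]
    (hX : IsFurstenbergBoundary G X) : IsRigidRetract G X := by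
  obtain ⟨X₀, _, _, _, _, _, ⟨x₀⟩, hm, hp, β, hβ⟩ := exists_universal_boundary G
  obtain ⟨h, hc, -, hh⟩ := hX.2 X₀ (hp.isRigidRetract hm x₀ hβ).isGBoundary
  obtain ⟨x⟩ := hX.1.nonempty
  let c : C(X₀, ℂ) →ₗ[ℂ] C(X, ℂ) :=
    { toFun := fun f => f.comp ⟨h, hc⟩
      map_add' := fun _ _ => rfl
      map_smul' := fun _ _ => rfl }
  have hcG : IsGMap G c := ⟨⟨rfl, fun f (hf : ∀ y, 0 ≤ f y) x => hf (h x)⟩, fun s f => by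
    ext x
    change f (s⁻¹ • h x) = f (h (s⁻¹ • x))
    rw [hh]⟩
  -- Pulling back along `X → X₀` extends `ℓ^∞(G) → C(X₀)` to a map into `C(X)`; rigidity of `X`
  -- comes from `X` being itself a boundary.
  exact (isStronglyProximal_iff.1 hX.1.stronglyProximal).isRigidRetract hX.1.minimal x
    (hcG.comp hβ)

theorem isFurstenbergBoundary {X : Type u} [TopologicalSpace X]
    [CompactSpace X] [T2Space X] [MulAction G X] [ContinuousConstSMul G X]
    (hX : IsRigidRetract G X) : IsFurstenbergBoundary G X :=
  ⟨hX.isGBoundary, fun B _ _ _ hB => by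
    have := hB.compact
    have := hB.hausdorff
    have := hB.nonempty
    exact hX.exists_image (isStronglyProximal_iff.1 hB.stronglyProximal) hB.minimal⟩

/-- Evaluating `β` at a fixed point is an invariant mean. Conversely, an invariant mean `m` makes `f
↦ m(α f) 1` equivariant, so rigidity makes every function on `X` constant. -/
theorem subsingleton_iff (hX : IsRigidRetract G X) : Subsingleton X ↔ IsAmenable G := by
  constructor
  · intro hs
    obtain ⟨β, hβ⟩ := hX.exists_from
    obtain ⟨x⟩ := hX.nonempty
    refine ⟨ContinuousMap.evalₗ x ∘ₗ β, by simp [hβ.map_one], fun f hf => hβ.map_nonneg f hf x,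
      fun s f => ?_⟩
    have := hβ.equivariant s f
    change β (EllInfty.translate s f) x = β f x
    change β (EllInfty.translate s f) = _ at this
    rw [this, ContinuousMap.tr_apply, Subsingleton.elim (s⁻¹ • x) x]
  · rintro ⟨m, hm1, hmpos, hminv⟩
    obtain ⟨α, hα⟩ := hX.exists_to
    let θ : C(X, ℂ) →ₗ[ℂ] C(X, ℂ) :=
      { toFun := fun f => m (α f) • 1
        map_add' := fun f g => by rw [map_add, map_add, add_smul]
        map_smul' := fun c f => by rw [map_smul, map_smul, smul_assoc]; rfl }
    have hθ : IsGMap G θ := by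
      refine ⟨⟨?_, fun f hf x => ?_⟩, fun s f => ?_⟩
      · change m (α 1) • (1 : C(X, ℂ)) = 1
        rw [hα.map_one, hm1, one_smul]
      · have : 0 ≤ m (α f) := hmpos _ fun t => hα.map_nonneg f hf t
        simpa [θ] using this
      · have h1 : m (α (tr s f)) = m (α f) := by
          rw [hα.equivariant]
          exact hminv s (α f)
        change m (α (tr s f)) • (1 : C(X, ℂ)) = tr s (m (α f) • (1 : C(X, ℂ)))
        rw [h1]
        rfl
    have hid := hX.rigid θ hθ
    refine ⟨fun x y => ContinuousMap.eq_of_forall_apply_eq fun f => ?_⟩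
    have e := LinearMap.congr_fun hid f
    rw [LinearMap.id_apply] at e
    rw [← e]
    rfl

end IsRigidRetract

end RigidRetract

/-! ### Minimal projections on `ℓ^∞(G)` -/

section Projections

variable {G : Type u} {X : Type v} [TopologicalSpace X] [CompactSpace X]

theorem IsUnitalPositive.norm_apply_le_ellInfty {α : C(X, ℂ) →ₗ[ℂ] EllInfty G} (hα : IsUnitalPositive α)
    (f : C(X, ℂ)) : ‖α f‖ ≤ ‖f‖ :=
  lp.norm_le_of_forall_le (norm_nonneg f) fun t =>
    ((EllInfty.isUnitalPositive_eval t).comp hα).norm_apply_le f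

theorem IsUnitalPositive.norm_apply_le_continuousMap {β : EllInfty G →ₗ[ℂ] C(X, ℂ)}
    (hβ : IsUnitalPositive β) (f : EllInfty G) : ‖β f‖ ≤ ‖f‖ :=
  (ContinuousMap.norm_le _ (norm_nonneg f)).2 fun x =>
    ((ContinuousMap.isUnitalPositive_evalₗ x).comp hβ).norm_apply_le f

/-- If `C(X)` is a retract of `ℓ^∞(G)`, the retraction recovers the product. -/
theorem IsUnitalPositive.retract_mul {α : C(X, ℂ) →ₗ[ℂ] EllInfty G} (hα : IsUnitalPositive α)
    {β : EllInfty G →ₗ[ℂ] C(X, ℂ)} (hβ : IsUnitalPositive β) (h : ∀ f, β (α f) = f)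
    (f g : C(X, ℂ)) : β (α f * α g) = f * g := by
  have hstar : ∀ f, IsSelfAdjoint f → IsSelfAdjoint (α f) := fun f hf => EllInfty.ext fun t => by
    have := ((EllInfty.isUnitalPositive_eval t).comp hα).apply_star f
    rw [hf.star_eq] at this
    exact this.symm
  -- Kadison's inequality for `α`, pushed through `β`, gives one bound; Kadison's inequality for `β`
  -- gives the other. Products then follow by polarization.
  have hsq : ∀ f, IsSelfAdjoint f → β (α f * α f) = f * f := by
    intro f hf
    ext x
    have hx := (ContinuousMap.isUnitalPositive_evalₗ x).comp hβ
    apply le_antisymm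
    · have h1 : 0 ≤ α (f * f) - α f * α f := fun t => by
        have := ((EllInfty.isUnitalPositive_eval t).comp hα).sq_apply_le hf
        have e : (α (f * f) - α f * α f) t = α (f * f) t - α f t ^ 2 := by
          rw [sq]; rfl
        change 0 ≤ (α (f * f) - α f * α f) t
        rw [e]
        exact sub_nonneg.2 this
      have h2 := hx.map_nonneg _ h1
      rw [map_sub, sub_nonneg] at h2
      simpa [h] using h2
    · have := hx.sq_apply_le (hstar f hf)
      simpa [h, sq] using this
  have hreal : ∀ f g, IsSelfAdjoint f → IsSelfAdjoint g → β (α f * α g) = f * g := by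
    intro f g hf hg
    have h1 := hsq (f + g) (hf.add hg)
    have e : α (f + g) * α (f + g) = α f * α f + (2 : ℂ) • (α f * α g) + α g * α g := by
      refine EllInfty.ext fun t => ?_
      change α (f + g) t * α (f + g) t = α f t * α f t + 2 * (α f t * α g t) + α g t * α g t
      rw [map_add]
      change (α f t + α g t) * (α f t + α g t) = _
      ring
    rw [e, map_add, map_add, map_smul, hsq f hf, hsq g hg] at h1
    ext x
    have h2 := congrArg (fun k : C(X, ℂ) => k x) h1
    simp only [ContinuousMap.add_apply, ContinuousMap.mul_apply, ContinuousMap.smul_apply,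
      smul_eq_mul] at h2 ⊢
    linear_combination (1 / 2) * h2
  rw [f.eq_toComplex_add, g.eq_toComplex_add]
  simp only [map_add, map_smul, add_mul, mul_add, smul_mul_assoc, mul_smul_comm,
    hreal _ _ (ContinuousMap.isSelfAdjoint_toComplex _) (ContinuousMap.isSelfAdjoint_toComplex _)]

theorem IsUnitalPositive.map_star_ellInfty {α : C(X, ℂ) →ₗ[ℂ] EllInfty G}
    (hα : IsUnitalPositive α) (f : C(X, ℂ)) : α (star f) = star (α f) :=
  EllInfty.ext fun t => ((EllInfty.isUnitalPositive_eval t).comp hα).apply_star f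

variable [Group G] [MulAction G X] [ContinuousConstSMul G X]

theorem EllInfty.IsGProjection.isGMap {ψ : EllInfty G →ₗ[ℂ] EllInfty G}
    (hψ : EllInfty.IsGProjection ψ) : IsGMap G ψ :=
  ⟨⟨hψ.unital, hψ.positive⟩, hψ.equivariant⟩

variable {α : C(X, ℂ) →ₗ[ℂ] EllInfty G} {β : EllInfty G →ₗ[ℂ] C(X, ℂ)}
  {ψ : EllInfty G →ₗ[ℂ] EllInfty G}

namespace IsGRigid

/-- Let `ψ` have range inside that of `α`. Rigidity gives `β ψ α = id`; as `ψ (α f)` has the form `α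
g`, applying `β` shows `g = f`. So `ψ` fixes the range of `α` and its own range is no smaller. -/
theorem isMinimalGProjection_comp (hX : IsGRigid G X) (hα : IsGMap G α) (hβ : IsGMap G β) :
    EllInfty.IsMinimalGProjection (α ∘ₗ β) := by
  have hid := fun f => IsRigidRetract.comp_eq_id hX hα hβ f
  have hp := hα.comp hβ
  refine ⟨⟨hp.map_one, hp.map_nonneg, hp.equivariant, fun f => by
    simp only [LinearMap.comp_apply, hid]⟩, fun ψ hψ hle => le_antisymm hle ?_⟩
  have h1 := fun f => IsRigidRetract.comp_eq_id hX (hψ.isGMap.comp hα) hβ f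
  have h2 : ∀ f, ψ (α f) = α f := by
    intro f
    obtain ⟨g, hg⟩ := hle ⟨α f, rfl⟩
    have := h1 f
    rw [LinearMap.comp_apply, ← hg, LinearMap.comp_apply, hid] at this
    rw [← hg, LinearMap.comp_apply, this]
  rintro _ ⟨g, rfl⟩
  exact ⟨α (β g), h2 (β g)⟩

/-- If `ψ` is a minimal projection, its image is `C(X)`. -/
theorem isImageIso (hX : IsGRigid G X) (hα : IsGMap G α) (hβ : IsGMap G β)
    (hψ : EllInfty.IsMinimalGProjection ψ) : EllInfty.IsImageIso ψ (ψ ∘ₗ α) := by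
  have hj := hψ.projection.isGMap.comp hα
  have hid : ∀ f, β (ψ (α f)) = f := fun f => IsRigidRetract.comp_eq_id hX hj hβ f
  -- This projection has range inside that of `ψ`, so minimality forces the range of `ψ ∘ α` to be
  -- everything.
  have hp : EllInfty.IsGProjection ((ψ ∘ₗ α) ∘ₗ β) := by
    have := hj.comp hβ
    exact ⟨this.map_one, this.map_nonneg, this.equivariant, fun f => by
      simp only [LinearMap.comp_apply, hid]⟩
  have hrange : LinearMap.range (ψ ∘ₗ α) = LinearMap.range ψ := by
    refine le_antisymm (LinearMap.range_comp_le_range _ _) ?_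
    rw [← hψ.minimal _ hp (by
      rw [LinearMap.comp_assoc]; exact LinearMap.range_comp_le_range _ _)]
    exact LinearMap.range_comp_le_range _ _
  refine ⟨hrange, fun f => le_antisymm (IsUnitalPositive.norm_apply_le_ellInfty hj.toIsUnitalPositive f) ?_,
    hj.map_one, hj.toIsUnitalPositive.map_star_ellInfty, fun f g => ?_, hj.equivariant⟩
  · conv_lhs => rw [← hid f]
    exact IsUnitalPositive.norm_apply_le_continuousMap hβ.toIsUnitalPositive _
  · have hk := hβ.comp hψ.projection.isGMap
    have hmul := hj.toIsUnitalPositive.retract_mul hk.toIsUnitalPositive (fun f => by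
      simp only [LinearMap.comp_apply, hψ.projection.idempotent, hid]) f g
    obtain ⟨h, hh⟩ : ψ ((ψ ∘ₗ α) f * (ψ ∘ₗ α) g) ∈ LinearMap.range (ψ ∘ₗ α) := by
      rw [hrange]; exact ⟨_, rfl⟩
    have e : h = f * g := by
      rw [← hmul, LinearMap.comp_apply, ← hh, LinearMap.comp_apply, hid]
    rw [← hh, e]

/-- If the embedding of `C(X)` is multiplicative, it identifies `C(X)` with a minimal image. -/
theorem isImageIso_starAlgHom (hX : IsGRigid G X) {α : C(X, ℂ) →⋆ₐ[ℂ] EllInfty G}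
    (hα : IsGMap G α.toLinearMap) (hβ : IsGMap G β) :
    EllInfty.IsImageIso (α.toLinearMap ∘ₗ β) α.toLinearMap := by
  have hid : ∀ f, β (α f) = f := fun f => IsRigidRetract.comp_eq_id hX hα hβ f
  refine ⟨le_antisymm ?_ (LinearMap.range_comp_le_range _ _), fun f => le_antisymm
    (IsUnitalPositive.norm_apply_le_ellInfty hα.toIsUnitalPositive f) ?_, hα.map_one, map_star α,
    fun f g => ?_, hα.equivariant⟩
  · rintro _ ⟨f, rfl⟩
    exact ⟨α f, congrArg α (hid f)⟩
  · conv_lhs => rw [← hid f]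
    exact IsUnitalPositive.norm_apply_le_continuousMap hβ.toIsUnitalPositive _
  · change α (f * g) = α (β (α f * α g))
    rw [← map_mul, hid]

end IsGRigid

theorem EllInfty.IsImageIso.isGMap {j : C(X, ℂ) →ₗ[ℂ] EllInfty G}
    (hj : EllInfty.IsImageIso ψ j) (hψ : EllInfty.IsGProjection ψ) : IsGMap G j := by
  refine ⟨⟨hj.map_one, fun f hf => ?_⟩, hj.equivariant⟩
  obtain ⟨g, rfl⟩ := CStarAlgebra.exists_eq_star_mul_self hf
  rw [hj.map_mul, hj.map_star]
  exact hψ.isGMap.map_nonneg _ (star_mul_self_nonneg _)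

/-- A space whose algebra is a minimal image is a rigid retract. -/
theorem IsRigidRetract.of_isImageIso (hX : IsRigidRetract G X) {Y : Type w} [TopologicalSpace Y]
    [CompactSpace Y] [MulAction G Y] [ContinuousConstSMul G Y]
    (hψ : EllInfty.IsMinimalGProjection ψ) {j : C(Y, ℂ) →ₗ[ℂ] EllInfty G}
    (hj : EllInfty.IsImageIso ψ j) : IsRigidRetract G Y := by
  obtain ⟨α, hα⟩ := hX.exists_to
  obtain ⟨β, hβ⟩ := hX.exists_from
  have hi := hX.rigid.isImageIso hα hβ hψ
  have hiG := hi.isGMap hψ.projection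
  have hjG := hj.isGMap hψ.projection
  set i := ψ ∘ₗ α
  have hβi : ∀ f, β (i f) = f := fun f => comp_eq_id hX.rigid hiG hβ f
  have hinj : Function.Injective j := by
    refine (injective_iff_map_eq_zero j).2 fun f hf => ?_
    rw [← norm_eq_zero, ← hj.norm_map, hf, norm_zero]
  have hmem : ∀ f, i f ∈ LinearMap.range j := fun f => by
    rw [hj.range_eq, ← hi.range_eq]; exact ⟨f, rfl⟩
  -- The comparison `j⁻¹ ∘ i` of two identifications of the same image. It preserves adjoints and
  -- products, since both carry the same Choi-Effros product, and is therefore positive.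
  let k : C(X, ℂ) →ₗ[ℂ] C(Y, ℂ) :=
    (LinearEquiv.ofInjective j hinj).symm.toLinearMap ∘ₗ i.codRestrict _ hmem
  have hjk : ∀ f, j (k f) = i f := fun f =>
    congrArg Subtype.val ((LinearEquiv.ofInjective j hinj).apply_symm_apply ⟨i f, hmem f⟩)
  have hk : IsGMap G k := by
    refine ⟨⟨hinj ?_, fun f hf => ?_⟩, fun s f => hinj ?_⟩
    · rw [hjk, hi.map_one, hj.map_one]
    · obtain ⟨g, rfl⟩ := CStarAlgebra.exists_eq_star_mul_self hf
      have : k (star g * g) = star (k g) * k g := hinj (by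
        rw [hjk, hi.map_mul, hi.map_star, hj.map_mul, hj.map_star, hjk])
      rw [this]
      exact star_mul_self_nonneg _
    · rw [hjk, hiG.equivariant, hjG.equivariant, hjk]
  refine hX.of_equiv (hβ.comp hjG) hk (LinearMap.ext fun f => hinj ?_)
  obtain ⟨g, hg⟩ : j f ∈ LinearMap.range i := by
    rw [hi.range_eq, ← hj.range_eq]; exact ⟨f, rfl⟩
  change j (k (β (j f))) = j f
  rw [hjk, ← hg, hβi]

end Projections

/-! ### Operator systems: states, extensions and envelopes -/

namespace GOperatorSystem

variable {G : Type u} [Group G]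

/-- States on an operator system. -/
structure IsState {T : GOperatorSystem.{u, v} G} (τ : T.carrier →ₗ[ℂ] ℂ) : Prop where
  map_unit : τ T.unit = 1
  map_nonneg : ∀ x : T.carrier, 0 ≤ (x : T.Ambient) → 0 ≤ τ x

theorem IsCompletelyPositive.map_nonneg {S : GOperatorSystem.{u, v} G}
    {T : GOperatorSystem.{u, w} G} {φ : S.carrier →ₗ[ℂ] T.carrier} (hφ : IsCompletelyPositive φ)
    (x : S.carrier) (hx : 0 ≤ (x : S.Ambient)) : 0 ≤ (φ x : T.Ambient) :=
  (CStarMatrix.map_one_by_one_nonneg_iff x (fun x => (φ x : T.Ambient))).1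
    (hφ 1 _ ((CStarMatrix.map_one_by_one_nonneg_iff x (fun x => (x : S.Ambient))).2 hx))

theorem IsCompletelyIsometric.norm_map {S : GOperatorSystem.{u, v} G}
    {T : GOperatorSystem.{u, w} G} {φ : S.carrier →ₗ[ℂ] T.carrier} (hφ : IsCompletelyIsometric φ)
    (x : S.carrier) : ‖(φ x : T.Ambient)‖ = ‖(x : S.Ambient)‖ := by
  have := hφ 1 (fun _ _ => x)
  rwa [CStarMatrix.norm_map_one_by_one x (fun x => (φ x : T.Ambient)),
    CStarMatrix.norm_map_one_by_one x (fun x => (x : S.Ambient))] at this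

theorem act_nonneg (T : GOperatorSystem.{u, v} G) (s : G) (x : T.carrier)
    (hx : 0 ≤ (x : T.Ambient)) : 0 ≤ (T.act s x : T.Ambient) :=
  (CStarMatrix.map_one_by_one_nonneg_iff x (fun x => (T.act s x : T.Ambient))).1
    (T.act_completelyPositive s 1 _
      ((CStarMatrix.map_one_by_one_nonneg_iff x (fun x => (x : T.Ambient))).2 hx))

theorem norm_map_le {S : GOperatorSystem.{u, v} G} {T : GOperatorSystem.{u, w} G}
    {φ : S.carrier →ₗ[ℂ] T.carrier} (h1 : IsUnital φ) (hφ : IsCompletelyPositive φ) (n : ℕ)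
    (M : CStarMatrix (Fin n) (Fin n) S.carrier) :
    ‖M.map (fun x => (φ x : T.Ambient))‖ ≤ ‖M.map (fun x => (x : S.Ambient))‖ :=
  CStarMatrix.norm_map_le_of_completelyPositive S.one_mem S.star_mem T.one_mem φ h1 hφ n M

/-- Both maps are completely contractive, so neither can shrink a norm. -/
theorem isCompletelyIsometric_of_leftInverse {S : GOperatorSystem.{u, v} G}
    {T : GOperatorSystem.{u, w} G} {φ : S.carrier →ₗ[ℂ] T.carrier} (h1 : IsUnital φ)
    (hφ : IsCompletelyPositive φ) {ψ : T.carrier →ₗ[ℂ] S.carrier} (h1' : IsUnital ψ)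
    (hψ : IsCompletelyPositive ψ) (h : ∀ x, ψ (φ x) = x) : IsCompletelyIsometric φ := by
  intro n M
  refine le_antisymm (norm_map_le h1 hφ n M) ?_
  have := norm_map_le h1' hψ n (M.map φ)
  have e : (M.map φ).map (fun x => (ψ x : S.Ambient)) = M.map (fun x => (x : S.Ambient)) := by
    ext i j
    simp only [CStarMatrix.map_apply, h]
  rw [e] at this
  exact this

namespace IsState

variable {T : GOperatorSystem.{u, v} G} {τ : T.carrier →ₗ[ℂ] ℂ}

theorem norm_apply_le (hτ : IsState τ) (x : T.carrier) : ‖τ x‖ ≤ ‖(x : T.Ambient)‖ :=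
  OperatorSystem.norm_apply_le T.one_mem T.star_mem τ hτ.map_unit hτ.map_nonneg x

theorem comp_act (hτ : IsState τ) (s : G) : IsState (τ ∘ₗ T.act s) :=
  ⟨by
    have : T.act s T.unit = T.unit := T.act_one s
    rw [LinearMap.comp_apply, this, hτ.map_unit],
   fun x hx => hτ.map_nonneg _ (T.act_nonneg s x hx)⟩

/-- The equivariant map to `ℓ^∞(G)` defined by a state. -/
def toEllInfty (hτ : IsState τ) : T.carrier →ₗ[ℂ] EllInfty G :=
  EllInfty.ofFamily (fun t => τ ∘ₗ T.act t⁻¹) fun x =>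
    ⟨‖(x : T.Ambient)‖, fun t => (hτ.comp_act t⁻¹).norm_apply_le x⟩

theorem toEllInfty_apply (hτ : IsState τ) (x : T.carrier) (t : G) :
    hτ.toEllInfty x t = τ (T.act t⁻¹ x) := rfl

theorem toEllInfty_unit (hτ : IsState τ) : hτ.toEllInfty T.unit = 1 :=
  EllInfty.ext fun t => (hτ.comp_act t⁻¹).map_unit

theorem toEllInfty_nonneg (hτ : IsState τ) (x : T.carrier) (hx : 0 ≤ (x : T.Ambient)) :
    0 ≤ hτ.toEllInfty x :=
  fun t => (hτ.comp_act t⁻¹).map_nonneg x hx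

theorem toEllInfty_act (hτ : IsState τ) (s : G) (x : T.carrier) :
    hτ.toEllInfty (T.act s x) = tr s (hτ.toEllInfty x) :=
  EllInfty.ext fun t => by
    rw [EllInfty.tr_apply, toEllInfty_apply, toEllInfty_apply, mul_inv_rev, inv_inv, map_mul]
    rfl

end IsState

/-- States extend along unital isometric maps of operator systems. -/
theorem exists_state_extension {S : GOperatorSystem.{u, v} G} {T : GOperatorSystem.{u, w} G}
    {ι : S.carrier →ₗ[ℂ] T.carrier} (h1 : IsUnital ι) (hι : IsCompletelyIsometric ι)
    {σ : S.carrier →ₗ[ℂ] ℂ} (hσ : IsState σ) :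
    ∃ τ : T.carrier →ₗ[ℂ] ℂ, IsState τ ∧ ∀ x, τ (ι x) = σ x := by
  let j : S.carrier →ₗ[ℂ] T.Ambient := T.carrier.subtype ∘ₗ ι
  have hj : ∀ x, ‖j x‖ = ‖(x : S.Ambient)‖ := hι.norm_map
  have hinj : Function.Injective j := by
    refine (injective_iff_map_eq_zero j).2 fun x hx => ?_
    have := hj x
    rw [hx, norm_zero] at this
    exact Subtype.ext (norm_eq_zero.1 this.symm)
  let e := LinearEquiv.ofInjective j hinj
  have he : ∀ w : LinearMap.range j, j (e.symm w) = w := fun w =>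
    congrArg Subtype.val (e.apply_symm_apply w)
  have hju : j S.unit = 1 := congrArg Subtype.val h1
  have hmem : (1 : T.Ambient) ∈ LinearMap.range j := ⟨S.unit, hju⟩
  -- Since `ι` is isometric, `σ` transported to its range is contractive; Hahn-Banach extends it,
  -- and a contractive unital functional is positive.
  obtain ⟨τ, hτ, hext⟩ := _root_.exists_state_extension hmem (σ ∘ₗ e.symm.toLinearMap) (by
    have : e.symm ⟨1, hmem⟩ = S.unit := hinj (by rw [he, hju])
    change σ (e.symm ⟨1, hmem⟩) = 1
    rw [this, hσ.map_unit]) (fun w => by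
    refine (hσ.norm_apply_le _).trans ?_
    rw [← hj]
    exact (congrArg norm (he w)).le)
  refine ⟨τ ∘ₗ T.carrier.subtype, ⟨hτ.map_one, fun x hx => hτ.map_nonneg _ hx⟩, fun x => ?_⟩
  have := hext (e x)
  rw [LinearMap.comp_apply] at this
  change τ (j x) = σ (e.symm (e x)) at this
  rw [e.symm_apply_apply] at this
  exact this

variable (G) in
/-- Elements of the operator system `ℂ`, as complex numbers. -/
def toComplex : (complex G).carrier →ₗ[ℂ] ℂ where
  toFun c := c.1
  map_add' _ _ := rfl
  map_smul' _ _ := rfl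

theorem isState_complex : IsState (toComplex G) :=
  ⟨rfl, fun _ hx => hx⟩

/-! ### The operator systems of continuous functions -/

section ContinuousFunctions

variable {X : Type v} [TopologicalSpace X] [CompactSpace X] [MulAction G X]
  [ContinuousConstSMul G X]

variable (G X) in
/-- Continuous functions, as elements of the operator system `C(X)`. -/
def ofContinuousMap : C(X, ℂ) →ₗ[ℂ] (continuousFunctions G X).carrier :=
  { toFun := fun f => ⟨f, trivial⟩
    map_add' := fun _ _ => rfl
    map_smul' := fun _ _ => rfl }

variable (G X) in
/-- Elements of the operator system `C(X)`, as continuous functions. -/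
def toContinuousMap : (continuousFunctions G X).carrier →ₗ[ℂ] C(X, ℂ) where
  toFun f := f.1
  map_add' _ _ := rfl
  map_smul' _ _ := rfl

theorem isGUCP_ofContinuousMap_comp {T : GOperatorSystem.{u, w} G} {η : T.carrier →ₗ[ℂ] C(X, ℂ)}
    (h1 : η T.unit = 1) (hpos : ∀ x : T.carrier, 0 ≤ (x : T.Ambient) → 0 ≤ η x)
    (heq : ∀ s x, η (T.act s x) = tr s (η x)) : IsGUCP (ofContinuousMap G X ∘ₗ η) where
  unital := Subtype.ext h1
  completelyPositive _ M hM :=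
    CStarMatrix.map_nonneg_of_positive T.one_mem T.star_mem η h1 hpos M hM
  equivariant s x := Subtype.ext (heq s x)

theorem IsGUCP.isGMap {Y : Type w} [TopologicalSpace Y] [CompactSpace Y] [MulAction G Y]
    [ContinuousConstSMul G Y]
    {φ : (continuousFunctions G X).carrier →ₗ[ℂ] (continuousFunctions G Y).carrier}
    (hφ : IsGUCP φ) : IsGMap G (toContinuousMap G Y ∘ₗ φ ∘ₗ ofContinuousMap G X) where
  map_one := congrArg Subtype.val hφ.unital
  map_nonneg f hf := hφ.completelyPositive.map_nonneg ⟨f, trivial⟩ hf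
  equivariant s f := congrArg Subtype.val (hφ.equivariant s ⟨f, trivial⟩)

theorem IsGUCP.comp {R : GOperatorSystem.{u, u} G} {S : GOperatorSystem.{u, v} G}
    {T : GOperatorSystem.{u, w} G} {ψ : S.carrier →ₗ[ℂ] T.carrier} {φ : R.carrier →ₗ[ℂ] S.carrier}
    (hψ : IsGUCP ψ) (hφ : IsGUCP φ) : IsGUCP (ψ ∘ₗ φ) where
  unital := by
    change ψ (φ R.unit) = T.unit
    rw [hφ.unital, hψ.unital]
  completelyPositive n M hM := hψ.completelyPositive n (M.map φ) (hφ.completelyPositive n M hM)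
  equivariant s x := by
    simp only [LinearMap.comp_apply]
    rw [hφ.equivariant, hψ.equivariant]

variable (G X) in
/-- The embedding of `ℂ` as the constant functions. -/
def constants : (complex G).carrier →ₗ[ℂ] (continuousFunctions G X).carrier :=
  ofContinuousMap G X ∘ₗ LinearMap.toSpanSingleton ℂ C(X, ℂ) 1 ∘ₗ toComplex G

theorem isGUCP_constants : IsGUCP (constants G X) :=
  isGUCP_ofContinuousMap_comp (T := complex G) (one_smul ℂ (1 : C(X, ℂ)))
    (fun c hc x => by
      change 0 ≤ toComplex G c * (1 : ℂ)
      rw [mul_one]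
      exact hc)
    (fun _ _ => rfl)

theorem isGExtension_constants [hX : Nonempty X] : IsGExtension (constants G X) where
  unital := isGUCP_constants.unital
  equivariant := isGUCP_constants.equivariant
  completelyIsometric := by
    obtain ⟨x⟩ := hX
    let ev : (continuousFunctions G X).carrier →ₗ[ℂ] (complex G).carrier :=
      { toFun := fun f => ⟨toContinuousMap G X f x, trivial⟩
        map_add' := fun _ _ => rfl
        map_smul' := fun _ _ => rfl }
    refine isCompletelyIsometric_of_leftInverse isGUCP_constants.unital
      isGUCP_constants.completelyPositive (ψ := ev) rfl (fun n M hM => ?_) fun c => ?_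
    · exact CompletelyPositiveMapClass.map_cstarMatrix_nonneg' (A₂ := ℂ)
        (ContinuousMap.evalStarAlgHom ℂ ℂ x : C(X, ℂ) →⋆ₐ[ℂ] ℂ) n
        (M.map (toContinuousMap G X)) hM
    · exact Subtype.ext (mul_one (toComplex G c))

/-- Any unital linear map from `ℂ` to `C(X)` is the embedding of the constants. -/
theorem eq_constants {ι : (complex G).carrier →ₗ[ℂ] (continuousFunctions G X).carrier}
    (h1 : IsUnital ι) : ι = constants G X := by
  ext c : 1
  have hc : c = toComplex G c • (complex G).unit := Subtype.ext (mul_one (toComplex G c)).symm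
  rw [hc, map_smul, map_smul, h1, isGUCP_constants.unital]

end ContinuousFunctions

/-! ### Rigid retracts as injective envelopes -/

section Envelopes

variable {X : Type u} [TopologicalSpace X] [CompactSpace X] [MulAction G X]
  [ContinuousConstSMul G X]

/-- A state on an operator system gives an equivariant map to a retract of `ℓ^∞(G)`. -/
theorem IsState.isGUCP {T : GOperatorSystem.{u, v} G} {τ : T.carrier →ₗ[ℂ] ℂ} (hτ : IsState τ)
    {β : EllInfty G →ₗ[ℂ] C(X, ℂ)} (hβ : IsGMap G β) :
    IsGUCP (ofContinuousMap G X ∘ₗ β ∘ₗ hτ.toEllInfty) :=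
  isGUCP_ofContinuousMap_comp
    (by rw [LinearMap.comp_apply, hτ.toEllInfty_unit, hβ.map_one])
    (fun x hx => hβ.map_nonneg _ (hτ.toEllInfty_nonneg x hx))
    (fun s x => by
      rw [LinearMap.comp_apply, hτ.toEllInfty_act, hβ.equivariant]; rfl)

theorem eq_id_of_isGUCP (hX : IsGRigid G X)
    {θ : (continuousFunctions G X).carrier →ₗ[ℂ] (continuousFunctions G X).carrier}
    (hθ : IsGUCP θ) (f : (continuousFunctions G X).carrier) : θ f = f :=
  Subtype.ext (LinearMap.congr_fun (hX _ hθ.isGMap) f.1)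

/-- An equivariant map into `ℓ^∞(G)` is determined by its value at the identity of `G`, a state.
That state extends by Hahn-Banach without regard to `G`; spreading it along its orbit restores
equivariance, and `β` returns to `C(X)`. -/
theorem _root_.IsRigidRetract.isGInjective (hX : IsRigidRetract G X) :
    IsGInjective (continuousFunctions G X) := by
  obtain ⟨α, hα⟩ := hX.exists_to
  obtain ⟨β, hβ⟩ := hX.exists_from
  intro S T ι φ hι hφ
  let σ : S.carrier →ₗ[ℂ] ℂ := EllInfty.eval 1 ∘ₗ α ∘ₗ toContinuousMap G X ∘ₗ φ
  have hσ : IsState σ := by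
    refine ⟨?_, fun x hx => ?_⟩
    · change α (toContinuousMap G X (φ S.unit)) 1 = 1
      rw [hφ.unital]
      exact congrArg (fun f : EllInfty G => f 1) hα.map_one
    · exact hα.map_nonneg _ (hφ.completelyPositive.map_nonneg x hx) 1
  obtain ⟨τ, hτ, hext⟩ := exists_state_extension hι.unital hι.completelyIsometric hσ
  refine ⟨_, hτ.isGUCP hβ, LinearMap.ext fun x => Subtype.ext ?_⟩
  have key : hτ.toEllInfty (ι x) = α (toContinuousMap G X (φ x)) := by
    refine EllInfty.ext fun t => ?_
    rw [IsState.toEllInfty_apply, ← hι.equivariant, hext]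
    change α (toContinuousMap G X (φ (S.act t⁻¹ x))) 1 = _
    rw [hφ.equivariant]
    have := hα.equivariant t⁻¹ (toContinuousMap G X (φ x))
    change α (tr t⁻¹ (toContinuousMap G X (φ x))) 1 = _
    rw [this, EllInfty.tr_apply, inv_inv, mul_one]
  change β (hτ.toEllInfty (ι x)) = toContinuousMap G X (φ x)
  rw [key, IsRigidRetract.comp_eq_id hX.rigid hα hβ]

/-- A state of `T` yields a map `T → C(X)`, which by rigidity is a left inverse of `φ`. -/
theorem _root_.IsRigidRetract.isGEssential (hX : IsRigidRetract G X) :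
    IsGEssential (constants G X) := by
  obtain ⟨β, hβ⟩ := hX.exists_from
  intro T φ hφ hiso
  obtain ⟨τ, hτ, -⟩ := exists_state_extension (ι := φ ∘ₗ constants G X) (by
    change φ (constants G X (complex G).unit) = T.unit
    rw [isGUCP_constants.unital, hφ.unital]) hiso isState_complex
  have hη := hτ.isGUCP hβ
  exact isCompletelyIsometric_of_leftInverse hφ.unital hφ.completelyPositive hη.unital
    hη.completelyPositive (eq_id_of_isGUCP hX.rigid (hη.comp hφ))

theorem _root_.IsRigidRetract.isHamanaBoundary (hX : IsRigidRetract G X) :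
    IsHamanaBoundary G X :=
  have := hX.nonempty
  ⟨constants G X, isGExtension_constants, hX.isGInjective, hX.isGEssential⟩

/-- Every envelope of `ℂ` is isomorphic to a rigid retract. -/
theorem IsGInjectiveEnvelope.exists_equiv (hX : IsRigidRetract G X) {U : GOperatorSystem.{u, u} G}
    {κ : (complex G).carrier →ₗ[ℂ] U.carrier} (hκ : IsGInjectiveEnvelope κ) :
    ∃ φ : U.carrier ≃ₗ[ℂ] (continuousFunctions G X).carrier,
      IsGExtension φ.toLinearMap ∧ IsGUCP φ.toLinearMap ∧ IsGUCP φ.symm.toLinearMap := by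
  obtain ⟨β, hβ⟩ := hX.exists_from
  have := hX.nonempty
  obtain ⟨τ, hτ, -⟩ := exists_state_extension hκ.extension.unital
    hκ.extension.completelyIsometric isState_complex
  have hφ := hτ.isGUCP hβ
  set φ := ofContinuousMap G X ∘ₗ β ∘ₗ hτ.toEllInfty
  have hφκ : φ ∘ₗ κ = constants G X := eq_constants (by
    change φ (κ (complex G).unit) = _
    rw [hκ.extension.unital, hφ.unital])
  have hiso : IsCompletelyIsometric φ := hκ.essential _ φ hφ (by
    rw [hφκ]; exact isGExtension_constants.completelyIsometric)
  have hext : IsGExtension φ := ⟨hφ.unital, hiso, hφ.equivariant⟩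
  -- Essentiality made `φ` an extension, so injectivity of `U` extends the identity along it. This
  -- gives a left inverse, which is also a right inverse by rigidity of `X`.
  obtain ⟨θ, hθ, hθφ⟩ := hκ.injective U (continuousFunctions G X) φ LinearMap.id hext
    ⟨rfl, fun _ _ h => h, fun _ _ => rfl⟩
  have hφθ : φ ∘ₗ θ = LinearMap.id := LinearMap.ext fun f =>
    eq_id_of_isGUCP hX.rigid (hφ.comp hθ) f
  exact ⟨LinearEquiv.ofLinearMap φ θ hφθ hθφ, hext, hφ, hθ⟩

theorem _root_.IsHamanaBoundary.isRigidRetract (hX : IsHamanaBoundary G X) :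
    IsRigidRetract G X := by
  obtain ⟨X₀, _, _, _, _, _, ⟨x⟩, hm, hp, β, hβ⟩ := exists_universal_boundary G
  have h₀ := hp.isRigidRetract hm x hβ
  obtain ⟨κ, hκ⟩ := hX
  obtain ⟨φ, -, h1, h2⟩ := hκ.exists_equiv h₀
  refine h₀.of_equiv h1.isGMap h2.isGMap (LinearMap.ext fun f => ?_)
  exact congrArg Subtype.val (φ.symm_apply_apply ⟨f, trivial⟩)

theorem _root_.isHamanaBoundary_iff_isRigidRetract :
    IsHamanaBoundary G X ↔ IsRigidRetract G X :=
  ⟨fun h => h.isRigidRetract, fun h => h.isHamanaBoundary⟩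

end Envelopes

end GOperatorSystem

end

/-! ### The main theorem, read off from rigid retracts -/

theorem mainTheorem4 (G : Type u) [Group G] :
    -- the Hamana boundary exists
    (∃ (X : Type u) (_ : TopologicalSpace X) (_ : CompactSpace X) (_ : T2Space X)
      (_ : MulAction G X) (_ : ContinuousConstSMul G X), IsHamanaBoundary G X) ∧
    -- it is unique up to `G`-equivariant homeomorphism
    (∀ (X Y : Type u) [TopologicalSpace X] [CompactSpace X] [T2Space X] [MulAction G X]
      [ContinuousConstSMul G X] [TopologicalSpace Y] [CompactSpace Y] [T2Space Y] [MulAction G Y]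
      [ContinuousConstSMul G Y], IsHamanaBoundary G X → IsHamanaBoundary G Y →
      ∃ h : X ≃ₜ Y, ∀ (s : G) (x : X), h (s • x) = s • h x) ∧
    -- the image of a unital positive equivariant projection on `ℓ^∞(G)` can be minimal
    (∃ ψ : EllInfty G →ₗ[ℂ] EllInfty G, EllInfty.IsMinimalGProjection ψ) ∧
    ∀ (X : Type u) [TopologicalSpace X] [CompactSpace X] [T2Space X] [MulAction G X]
      [ContinuousConstSMul G X],
      -- the Hamana boundary is the spectrum of a minimal image ...
      (IsHamanaBoundary G X ↔
        ∃ ψ : EllInfty G →ₗ[ℂ] EllInfty G, EllInfty.IsMinimalGProjection ψ ∧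
          ∃ j : C(X, ℂ) →ₗ[ℂ] EllInfty G, EllInfty.IsImageIso ψ j) ∧
      -- ... and is the same thing as the Furstenberg boundary
      (IsHamanaBoundary G X ↔ IsFurstenbergBoundary G X) ∧
      (IsHamanaBoundary G X →
        -- every `G`-injective envelope of `ℂ` is `C(X)`
        (∀ (U : GOperatorSystem.{u, u} G)
          (κ : (GOperatorSystem.complex G).carrier →ₗ[ℂ] U.carrier),
          GOperatorSystem.IsGInjectiveEnvelope κ →
          ∃ φ : U.carrier ≃ₗ[ℂ] (GOperatorSystem.continuousFunctions G X).carrier,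
            GOperatorSystem.IsGExtension φ.toLinearMap) ∧
        -- every minimal image is `C(X)`
        (∀ ψ : EllInfty G →ₗ[ℂ] EllInfty G, EllInfty.IsMinimalGProjection ψ →
          ∃ j : C(X, ℂ) →ₗ[ℂ] EllInfty G, EllInfty.IsImageIso ψ j) ∧
        -- some minimal image is a C*-subalgebra of `ℓ^∞(G)`
        (∃ (ψ : EllInfty G →ₗ[ℂ] EllInfty G) (j : C(X, ℂ) →⋆ₐ[ℂ] EllInfty G),
          EllInfty.IsMinimalGProjection ψ ∧ EllInfty.IsImageIso ψ j.toLinearMap) ∧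
        -- it is a `G`-boundary
        Nonempty X ∧ MulAction.IsMinimal G X ∧ IsStronglyProximal G X ∧
        -- it maps onto every `G`-boundary
        (∀ (B : Type v) [TopologicalSpace B] [MulAction G B] [ContinuousConstSMul G B],
          IsGBoundary G B → IsGImage G X B) ∧
        -- it is trivial exactly when `G` is amenable
        (Subsingleton X ↔ IsAmenable G)) := by
  obtain ⟨X₀, _, _, _, _, _, ⟨x₀⟩, hm, hp, β₀, hβ₀⟩ := exists_universal_boundary G
  have h₀ : IsRigidRetract G X₀ := hp.isRigidRetract hm x₀ hβ₀
  refine ⟨⟨X₀, _, inferInstance, inferInstance, _, inferInstance, h₀.isHamanaBoundary⟩, ?_,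
    ⟨_, h₀.rigid.isMinimalGProjection_comp (isGMap_orbitHom x₀) hβ₀⟩, ?_⟩
  · intro X Y _ _ _ _ _ _ _ _ _ _ hX hY
    exact hX.isRigidRetract.exists_homeomorph hY.isRigidRetract
  intro X _ _ _ _ _
  rw [isHamanaBoundary_iff_isRigidRetract]
  have himage : ∀ (_ : IsRigidRetract G X) (ψ : EllInfty G →ₗ[ℂ] EllInfty G),
      EllInfty.IsMinimalGProjection ψ →
      ∃ j : C(X, ℂ) →ₗ[ℂ] EllInfty G, EllInfty.IsImageIso ψ j := by
    intro hX ψ hψ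
    obtain ⟨α, hα⟩ := hX.exists_to
    obtain ⟨β, hβ⟩ := hX.exists_from
    exact ⟨_, hX.rigid.isImageIso hα hβ hψ⟩
  refine ⟨⟨fun hX => ?_, ?_⟩,
    ⟨fun hX => hX.isFurstenbergBoundary, fun hX => hX.isRigidRetract⟩, fun hX => ?_⟩
  · have hψ := h₀.rigid.isMinimalGProjection_comp (isGMap_orbitHom x₀) hβ₀
    exact ⟨_, hψ, himage hX _ hψ⟩
  · rintro ⟨ψ, hψ, j, hj⟩
    exact h₀.of_isImageIso hψ hj
  · refine ⟨fun U κ hκ => ?_, himage hX, ?_, hX.nonempty, hX.isMinimal,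
      isStronglyProximal_iff.2 hX.isStateProximal, fun B _ _ _ hB => ?_, hX.subsingleton_iff⟩
    · obtain ⟨φ, hφ, -⟩ := hκ.exists_equiv hX
      exact ⟨φ, hφ⟩
    · obtain ⟨x⟩ := hX.nonempty
      obtain ⟨β, hβ⟩ := hX.exists_from
      exact ⟨_, orbitHom x, hX.rigid.isMinimalGProjection_comp (isGMap_orbitHom x) hβ,
        hX.rigid.isImageIso_starAlgHom (isGMap_orbitHom x) hβ⟩
    · have := hB.compact
      have := hB.hausdorff
      have := hB.nonempty
      exact hX.exists_image (isStronglyProximal_iff.1 hB.stronglyProximal) hB.minimal
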